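/- Let $\mathcal G$ be a compact semisimple real Lie group with Lie algebra $\mathfrak g$, and let $\mathcal U$ be a (possibly projective) unitary representation of $\mathcal G$ on a complex Hilbert space $\mathcal H$, i.e. each $\mathcal U(M)$ is unitary and $\mathcal U(M_1)\mathcal U(M_2)=\mathcal U(M_1M_2)$ up to a phase. For $A\in\mathfrak g$ write $\hat A=\frac{d}{ds}\mathcal U(e^{sA})|_{s=0}$, extended complex-linearly to $\mathfrak g^{\mathbb C}$ (for a projective representation, with the phases of $\mathcal U$ chosen near the identity so that $M\mapsto\mathcal U(M)\phi$ is differentiable there and takes the value $\phi$ at the identity). For a Cartan subalgebra $\mathfrak h\subset\mathfrak g$ and a real-linear $\alpha:\mathfrak h\to\mathbb C$ let $\mathfrak v_\alpha=\{E\in\mathfrak g^{\mathbb C}: [H,E]=\alpha(H)E\ \ \forall H\in\mathfrak h\}$; the roots are the $\alpha\neq0$ with $\mathfrak v_\alpha\neq0$. A choice of positive roots is a set $\Delta^+$ of roots that contains exactly one of $\alpha,-\alpha$ for each root $\alpha$. A vector $\phi\in\mathcal H$, $\phi\ne0$, at which $M\mapsto \mathcal U(M)\phi$ is differentiable at the identity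 is a highest weight vector if, for some Cartan subalgebra $\mathfrak h$, some choice $\Delta^+$ of positive roots (and, for projective $\mathcal U$, some choice of phases as above), $\hat H\phi=\mu(H)\phi$ for all $H\in\mathfrak h$ with some linear $\mu:\mathfrak h\to\mathbb C$, and $\hat E\phi=0$ for all $E\in\mathfrak v_\alpha$, $\alpha\in\Delta^+$. Let $\phi$ be a highest weight vector and let $\mathcal M_\phi=\{[\mathcal U(M)\phi]: M\in\mathcal G\}\subset\mathcal P(\mathcal H)$ be the family of group-theoretic (Gilmore–Perelomov) coherent states. Its tangent space at the state represented by $|\psi\rangle$ is the real subspace $\mathcal T_\psi\mathcal M_\phi\subset\mathcal H$ spanned by the vectors $\mathbb Q_\psi\partial_\mu|\psi(x)\rangle$, where $|\psi(x)\rangle$ is a differentiable choice of representatives near the given state, parametrized by local coordinates $x$ of $\mathcal G$, and $\mathbb Q_\psi$ is the orthogonal projection onto $\{\psi\}^\perp$. Then such representatives exist near every point, $\mathcal T_\psi\mathcal M_\phi$ depends only on $|\psi\rangle$, and $\mathcal M_\phi$ is Kähler, in the following sense: at every point of $\mathcal M_\phi$ (and for every representative), the restricted metric $g(X,Y)=2\,\mathrm{Re}\langle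 X|Y\rangle/\langle\psi|\psi\rangle$ on $\mathcal T_\psi\mathcal M_\phi$ is positive definite, the restricted form $\omega(X,Y)=2\,\mathrm{Im}\langle X|Y\rangle/\langle\psi|\psi\rangle$ is antisymmetric and nondegenerate, and the linear map $J$ of $\mathcal T_\psi\mathcal M_\phi$ defined by $g(X,JY)=-\omega(X,Y)$ satisfies $J^2=-\mathrm{id}$. -/

import Mathlib

open scoped Manifold ContDiff TensorProduct InnerProductSpace LinearAlgebra.Projectivization Topology

noncomputable section

/-! ### Lie groups and their complexified Lie algebras -/

/-- A smooth real Lie group has the regularity that Mathlib requires in order to define its Lie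
algebra. -/
instance lieGroupMinSmoothness {n : ℕ} {G : Type*} [TopologicalSpace G]
    [ChartedSpace (EuclideanSpace ℝ (Fin n)) G] [Group G] [LieGroup (𝓡 n) ∞ G] :
    LieGroup (𝓡 n) (minSmoothness ℝ 3) G := by
  rw [minSmoothness_of_isRCLikeNormedField]
  infer_instance

/-- Extension of scalars `A ⊗ L` of a Lie algebra `L` over `R`. -/
abbrev LieBaseChange (R A L : Type*) [CommRing R] [CommRing A] [Algebra R A] [LieRing L]
    [LieAlgebra R L] : Type _ := A ⊗[R] L

/-- The element `1 ⊗ H` of the extension of scalars. -/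
abbrev toLieBaseChange (R A : Type*) {L : Type*} [CommRing R] [CommRing A] [Algebra R A]
    [LieRing L] [LieAlgebra R L] (H : L) : LieBaseChange R A L := (1 : A) ⊗ₜ[R] H

section Roots

variable {L : Type*} [LieRing L] [LieAlgebra ℝ L]

/-- The joint eigenspace `𝔳_α = {X ∈ 𝔤^ℂ | [H, X] = α(H) X for all H ∈ 𝔥}` in the complexification
`𝔤^ℂ = ℂ ⊗ 𝔤` of a real Lie algebra `𝔤`, for a real-linear map `α : 𝔥 → ℂ`. -/
def rootSpaceC (h : LieSubalgebra ℝ L) (α : h →ₗ[ℝ] ℂ) :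
    Submodule ℂ (LieBaseChange ℝ ℂ L) where
  carrier := {X | ∀ H : h, ⁅toLieBaseChange ℝ ℂ (H : L), X⁆ = α H • X}
  add_mem' := by
    intro X Y hX hY H
    rw [lie_add, hX H, hY H, smul_add]
  zero_mem' := by
    intro H
    rw [lie_zero, smul_zero]
  smul_mem' := by
    intro c X hX H
    rw [lie_smul, hX H, smul_comm]

/-- The root system `Δ`: the nonzero `α : 𝔥 → ℂ` whose joint eigenspace is nonzero. -/
def rootsC (h : LieSubalgebra ℝ L) : Set (h →ₗ[ℝ] ℂ) :=
  {α | α ≠ 0 ∧ rootSpaceC h α ≠ ⊥}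

/-- A choice of positive roots: a subset `Δ⁺ ⊆ Δ` such that of each pair `α, -α` of roots exactly
one belongs to `Δ⁺`.  (Closedness of `Δ⁺` under addition of roots is not required.) -/
structure IsPositiveRoots (h : LieSubalgebra ℝ L) (P : Set (h →ₗ[ℝ] ℂ)) : Prop where
  subset : P ⊆ rootsC h
  split : ∀ α ∈ rootsC h, Xor (α ∈ P) (-α ∈ P)

end Roots

/-! ### Kähler vector spaces and Kähler families of states -/

/-- A real vector space with a positive definite symmetric form `g` and a nondegenerate
antisymmetric form `σ` is a Kähler space if `J = -g⁻¹ σ`, i.e. the linear map determined by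
`g (X, J Y) = - σ (X, Y)`, satisfies `J² = -1`. -/
structure IsKahlerSpace {T : Type*} [AddCommGroup T] [Module ℝ T]
    (g σ : LinearMap.BilinForm ℝ T) : Prop where
  symm : ∀ X Y, g X Y = g Y X
  posDef : ∀ X, X ≠ 0 → 0 < g X X
  antisymm : ∀ X Y, σ X Y = -σ Y X
  nondegenerate : ∀ X, (∀ Y, σ X Y = 0) → X = 0
  complexStructure : ∃ J : T →ₗ[ℝ] T, (∀ X Y, g X (J Y) = -σ X Y) ∧ ∀ X, J (J X) = -X

section States

variable {V : Type*} [NormedAddCommGroup V] [InnerProductSpace ℂ V]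

/-- The restricted metric `g(X, Y) = 2 Re ⟪X, Y⟫ / ⟪ψ, ψ⟫` on a real subspace `T` of Hilbert
space. -/
def restrictedMetric (ψ : V) (T : Submodule ℝ V) : LinearMap.BilinForm ℝ T :=
  LinearMap.mk₂ ℝ (fun X Y => 2 * (⟪(X : V), (Y : V)⟫_ℂ).re / ‖ψ‖ ^ 2)
    (by intro X X' Y; simp; ring)
    (by intro c X Y; simp [← Complex.coe_smul]; ring)
    (by intro X Y Y'; simp; ring)
    (by intro c X Y; simp [← Complex.coe_smul]; ring)

/-- The restricted symplectic form `σ(X, Y) = 2 Im ⟪X, Y⟫ / ⟪ψ, ψ⟫` on a real subspace `T` of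
Hilbert space. -/
def restrictedSymplectic (ψ : V) (T : Submodule ℝ V) : LinearMap.BilinForm ℝ T :=
  LinearMap.mk₂ ℝ (fun X Y => 2 * (⟪(X : V), (Y : V)⟫_ℂ).im / ‖ψ‖ ^ 2)
    (by intro X X' Y; simp; ring)
    (by intro c X Y; simp [← Complex.coe_smul]; ring)
    (by intro X Y Y'; simp; ring)
    (by intro c X Y; simp [← Complex.coe_smul]; ring)

variable {N : Type*} [TopologicalSpace N]

/-- `ψ` is a differentiable choice of representatives, near `x`, of the family of states
`f : N → ℙ(V)`. -/
structure IsLocalLift (n : ℕ) [ChartedSpace (EuclideanSpace ℝ (Fin n)) N]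
    (f : N → ℙ ℂ V) (x : N) (ψ : N → V) : Prop where
  differentiableAt : MDifferentiableAt (𝓡 n) 𝓘(ℝ, V) ψ x
  lifts : ∀ᶠ y in 𝓝 x, ∃ hy : ψ y ≠ 0, Projectivization.mk ℂ (ψ y) hy = f y

/-- The tangent space at `x` of the family with representatives `ψ`: the real span of the vectors
`ℚ ∂_μ ψ(x)`, where `ℚ` is the orthogonal projection onto the complement of `ψ(x)`. -/
def stateTangentSpace (n : ℕ) [ChartedSpace (EuclideanSpace ℝ (Fin n)) N]
    (ψ : N → V) (x : N) : Submodule ℝ V :=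
  LinearMap.range
    ((((ℂ ∙ ψ x)ᗮ.starProjection.restrictScalars ℝ).toLinearMap) ∘ₗ
      (mfderiv (𝓡 n) 𝓘(ℝ, V) ψ x : TangentSpace (𝓡 n) x →L[ℝ] V).toLinearMap)

/-- A family of states `f : N → ℙ(V)` is Kähler if it is differentiable, if its tangent space at a
state depends only on the state and its representative (not on the parameter value), and if all its
tangent spaces, with the restricted metric and the restricted symplectic form, are Kähler spaces.
The parametrization may be redundant, i.e. `f` need not be an immersion: the tangent space is that
of the manifold of states, not that of the parameter space. -/
structure IsKahlerFamily (n : ℕ) [ChartedSpace (EuclideanSpace ℝ (Fin n)) N]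
    (f : N → ℙ ℂ V) : Prop where
  exists_lift : ∀ x, ∃ ψ, IsLocalLift n f x ψ
  tangent_wellDefined : ∀ x y ψ χ, IsLocalLift n f x ψ → IsLocalLift n f y χ → ψ x = χ y →
    stateTangentSpace n ψ x = stateTangentSpace n χ y
  kahler : ∀ x ψ, IsLocalLift n f x ψ →
    IsKahlerSpace (restrictedMetric (ψ x) (stateTangentSpace n ψ x))
      (restrictedSymplectic (ψ x) (stateTangentSpace n ψ x))

end States

/-! ### Unitary representations, highest weight vectors and coherent states -/

/-- A possibly projective unitary representation: `U(g) U(h)` and `U(gh)` agree up to a phase.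
Honest unitary representations are the case in which all these phases are `1`. -/
structure ProjectiveUnitaryRep (G V : Type*) [Group G] [NormedAddCommGroup V]
    [InnerProductSpace ℂ V] where
  toFun : G → V ≃ₗᵢ[ℂ] V
  mul : ∀ g h, ∃ c : Circle, ∀ v, toFun g (toFun h v) = (c : ℂ) • toFun (g * h) v

section Coherent

variable {G V : Type*} [Group G] [NormedAddCommGroup V] [InnerProductSpace ℂ V]

/-- The family of group-theoretic coherent states `M ↦ [U(M) φ] ∈ ℙ(V)`, whose range is the manifold
`ℳ_φ`. -/
def coherentState (U : ProjectiveUnitaryRep G V) (φ : V) (hφ : φ ≠ 0) (M : G) : ℙ ℂ V :=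
  Projectivization.mk ℂ (U.toFun M φ) ((map_ne_zero_iff _ (U.toFun M).injective).mpr hφ)

variable [TopologicalSpace G]

/-- `A ↦ Â φ = d/ds ψ(exp(sA))` at `s = 0`, where `ψ(M)` represents the state `U(M) φ`. -/
def infinitesimalAction (n : ℕ) [ChartedSpace (EuclideanSpace ℝ (Fin n)) G]
    (ψ : G → V) : GroupLieAlgebra (𝓡 n) G →ₗ[ℝ] V :=
  (mfderiv (𝓡 n) 𝓘(ℝ, V) ψ (1 : G) : TangentSpace (𝓡 n) (1 : G) →L[ℝ] V).toLinearMap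

/-- The complex-linear extension of `A ↦ Â φ` to the complexified Lie algebra. -/
def infinitesimalActionC (n : ℕ) [ChartedSpace (EuclideanSpace ℝ (Fin n)) G]
    [LieGroup (𝓡 n) ∞ G] (ψ : G → V) :
    LieBaseChange ℝ ℂ (GroupLieAlgebra (𝓡 n) G) →ₗ[ℂ] V :=
  LinearMap.liftBaseChange ℂ (infinitesimalAction n ψ)

/-- `φ ≠ 0` is a highest weight vector with respect to the Cartan subalgebra `h` of `𝔤`, the
positive roots `P`, and the choice of phases `θ`: the map `M ↦ θ(M) U(M) φ` is differentiable at
`1` with value `φ` there, `φ` is a joint eigenvector of all `Ĥ` with `H ∈ 𝔥`, and `Ê φ = 0` for all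
`E ∈ 𝔳_α`, `α ∈ Δ⁺`.  The operators of a projective representation are determined only up to phases
(equivalently, `Â` only up to adding imaginary multiples of the identity), which `θ` fixes near `1`;
for an honest representation one takes `θ = 1`. -/
structure IsHighestWeightFor (n : ℕ) [ChartedSpace (EuclideanSpace ℝ (Fin n)) G]
    [LieGroup (𝓡 n) ∞ G] (U : ProjectiveUnitaryRep G V) (φ : V)
    (h : LieSubalgebra ℝ (GroupLieAlgebra (𝓡 n) G)) (P : Set (h →ₗ[ℝ] ℂ))
    (θ : G → Circle) : Prop where
  ne_zero : φ ≠ 0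
  cartan : h.IsCartanSubalgebra
  positive : IsPositiveRoots h P
  map_one : (θ 1 : ℂ) • U.toFun 1 φ = φ
  differentiableAt : MDifferentiableAt (𝓡 n) 𝓘(ℝ, V) (fun M => (θ M : ℂ) • U.toFun M φ) 1
  weight : ∃ μ : h →ₗ[ℝ] ℂ, ∀ H : h,
    infinitesimalAction n (fun M => (θ M : ℂ) • U.toFun M φ) (H : GroupLieAlgebra (𝓡 n) G) =
      μ H • φ
  annihilated : ∀ α ∈ P, ∀ X ∈ rootSpaceC h α,
    infinitesimalActionC n (fun M => (θ M : ℂ) • U.toFun M φ) X = 0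

/-- A highest weight vector: one with respect to some Cartan subalgebra and some choice of positive
roots. -/
def IsHighestWeightVector (n : ℕ) [ChartedSpace (EuclideanSpace ℝ (Fin n)) G]
    [LieGroup (𝓡 n) ∞ G] (U : ProjectiveUnitaryRep G V) (φ : V) : Prop :=
  ∃ (h : LieSubalgebra ℝ (GroupLieAlgebra (𝓡 n) G)) (P : Set (h →ₗ[ℝ] ℂ)) (θ : G → Circle),
    IsHighestWeightFor n U φ h P θ

lemma IsHighestWeightVector.ne_zero {n : ℕ} [ChartedSpace (EuclideanSpace ℝ (Fin n)) G]
    [LieGroup (𝓡 n) ∞ G] {U : ProjectiveUnitaryRep G V} {φ : V}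
    (hφ : IsHighestWeightVector n U φ) : φ ≠ 0 := by
  obtain ⟨h, P, θ, H⟩ := hφ
  exact H.ne_zero

end Coherent

end

/-! The tangent space at `φ` is the image of the real-linear map `b(A) = ℚ Â φ` on `𝔤`. Once this
image is stable under multiplication by `i`, the Kähler conditions follow with `J = i`
(`isKahlerSpace_of_I_smul_mem`).

Stability under `i` is where the highest weight condition enters
(`exists_eq_I_smul_of_isPositiveRoots`). Let `bC` be the complex-linear extension of `b`. It
vanishes on `𝔥`, because `ℚ` kills multiples of `φ`, and on the positive root spaces. Real elements
are sums of elements `X + X̄` with `X` in the complexified Cartan subalgebra or in a root space. If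
`X ∈ 𝔳_α`, then `X̄ ∈ 𝔳_{-α}`, and one of `α`, `-α` is positive, so one of `bC X`, `bC X̄` is zero.
Hence `i bC(X + X̄)` is, up to sign, `bC(iX + conj(iX))`, the value of `b` at a real element.

The root decomposition and `X̄ ∈ 𝔳_{-α}` rest on an inner product for which every `ad A` is skew
(`exists_lie_invariant_form`): Haar averaging gives an `Ad`-invariant inner product, and the bracket
of left-invariant fields is the derivative of `Ad` (`lie_eq_hasFDerivAt_adjointAction`).

Left translation by the unitary `U(M)` carries the result from the identity to `M`; changing
representatives only multiplies the tangent space by a complex scalar. Right translation by the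
stabilizer of the state shows independence of the parameter. -/

noncomputable section LinearAlgebra

/-! ### Skew operators have no nontrivial Jordan blocks -/

/-- If `ker N² = ker N`, then `ker Nᵏ⁺¹ = ker N` for all `k`. -/
lemma apply_eq_zero_of_pow_succ_apply_eq_zero {R M : Type*} [Ring R] [AddCommGroup M] [Module R M]
    (N : Module.End R M) (hN : ∀ x, N (N x) = 0 → N x = 0) (k : ℕ) (x : M)
    (hx : (N ^ (k + 1)) x = 0) : N x = 0 := by
  induction k generalizing x with
  | zero => simpa using hx
  | succ k ih =>
    rw [pow_succ, Module.End.mul_apply] at hx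
    exact hN x (ih _ hx)

/-- A skew-symmetric operator for a positive definite form satisfies `ker N² = ker N`. -/
lemma apply_eq_zero_of_skew {M : Type*} [AddCommGroup M] [Module ℝ M] {B : LinearMap.BilinForm ℝ M}
    (hpos : ∀ x, x ≠ 0 → 0 < B x x) {N : M → M} (hN : ∀ x y, B (N x) y + B x (N y) = 0) (x : M)
    (hx : N (N x) = 0) : N x = 0 := by
  by_contra h
  have h1 := hpos _ h
  have h2 := hN x (N x)
  rw [hx, map_zero, add_zero] at h2
  exact h1.ne' h2

/-! ### Real and imaginary parts in the complexified Lie algebra -/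

section Complexification

variable {L : Type*} [LieRing L] [LieAlgebra ℝ L]

/-- The real part of an element of the complexification of a real Lie algebra. -/
def reComplexification (L : Type*) [LieRing L] [LieAlgebra ℝ L] : LieBaseChange ℝ ℂ L →ₗ[ℝ] L :=
  (TensorProduct.lid ℝ L).toLinearMap ∘ₗ Complex.reLm.rTensor L

/-- The imaginary part of an element of the complexification of a real Lie algebra. -/
def imComplexification (L : Type*) [LieRing L] [LieAlgebra ℝ L] : LieBaseChange ℝ ℂ L →ₗ[ℝ] L :=
  (TensorProduct.lid ℝ L).toLinearMap ∘ₗ Complex.imLm.rTensor L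

local notation "reC" => reComplexification L
local notation "imC" => imComplexification L

@[simp] lemma reComplexification_tmul (z : ℂ) (x : L) : reC (z ⊗ₜ[ℝ] x) = z.re • x := by
  simp [reComplexification]

@[simp] lemma imComplexification_tmul (z : ℂ) (x : L) : imC (z ⊗ₜ[ℝ] x) = z.im • x := by
  simp [imComplexification]

lemma eq_re_add_im (X : LieBaseChange ℝ ℂ L) :
    X = (1 : ℂ) ⊗ₜ[ℝ] reC X + Complex.I ⊗ₜ[ℝ] imC X := by
  induction X using TensorProduct.induction_on with
  | zero => simp
  | tmul z x =>
    simp only [reComplexification_tmul, imComplexification_tmul, TensorProduct.tmul_smul,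
      TensorProduct.smul_tmul']
    rw [← TensorProduct.add_tmul]
    congr 1
    apply Complex.ext <;> simp
  | add X Y hX hY =>
    conv_lhs => rw [hX, hY]
    simp only [map_add, TensorProduct.tmul_add]
    abel

lemma complexification_ext {X Y : LieBaseChange ℝ ℂ L} (hre : reC X = reC Y)
    (him : imC X = imC Y) : X = Y := by
  rw [eq_re_add_im X, eq_re_add_im Y, hre, him]

lemma reComplexification_smul (c : ℂ) (X : LieBaseChange ℝ ℂ L) :
    reC (c • X) = c.re • reC X - c.im • imC X := by
  induction X using TensorProduct.induction_on with
  | zero => simp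
  | tmul z x => simp [TensorProduct.smul_tmul', sub_smul, mul_smul]
  | add X Y hX hY => simp only [smul_add, map_add, hX, hY]; abel

lemma imComplexification_smul (c : ℂ) (X : LieBaseChange ℝ ℂ L) :
    imC (c • X) = c.re • imC X + c.im • reC X := by
  induction X using TensorProduct.induction_on with
  | zero => simp
  | tmul z x => simp [TensorProduct.smul_tmul', add_smul, mul_smul]
  | add X Y hX hY => simp only [smul_add, map_add, hX, hY]; abel

lemma reComplexification_lie (a : L) (X : LieBaseChange ℝ ℂ L) :
    reC ⁅toLieBaseChange ℝ ℂ a, X⁆ = ⁅a, reC X⁆ := by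
  induction X using TensorProduct.induction_on with
  | zero => simp
  | tmul z x => simp [toLieBaseChange, LieAlgebra.ExtendScalars.bracket_tmul]
  | add X Y hX hY => simp only [lie_add, map_add, hX, hY]

lemma imComplexification_lie (a : L) (X : LieBaseChange ℝ ℂ L) :
    imC ⁅toLieBaseChange ℝ ℂ a, X⁆ = ⁅a, imC X⁆ := by
  induction X using TensorProduct.induction_on with
  | zero => simp
  | tmul z x => simp [toLieBaseChange, LieAlgebra.ExtendScalars.bracket_tmul]
  | add X Y hX hY => simp only [lie_add, map_add, hX, hY]

/-- Complex conjugation of the complexification of a real Lie algebra. -/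
def conjComplexification (X : LieBaseChange ℝ ℂ L) : LieBaseChange ℝ ℂ L :=
  (1 : ℂ) ⊗ₜ[ℝ] reC X - Complex.I ⊗ₜ[ℝ] imC X

lemma reComplexification_conj (X : LieBaseChange ℝ ℂ L) :
    reC (conjComplexification X) = reC X := by
  simp [conjComplexification]

lemma imComplexification_conj (X : LieBaseChange ℝ ℂ L) :
    imC (conjComplexification X) = -imC X := by
  simp [conjComplexification]

/-- This brings values of a complex-linear extension at `X + X̄` back to values of the original
real-linear map. -/
lemma add_conjComplexification (X : LieBaseChange ℝ ℂ L) :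
    X + conjComplexification X = (1 : ℂ) ⊗ₜ[ℝ] ((2 : ℝ) • reC X) := by
  apply complexification_ext <;>
    simp [reComplexification_conj, imComplexification_conj, two_smul]

/-! ### Root decomposition from an invariant inner product -/

section Invariant

variable {B : LinearMap.BilinForm ℝ L}

/-- The real bilinear form on the complexification, induced from a form on the real Lie algebra. -/
def complexificationForm (B : LinearMap.BilinForm ℝ L) :
    LinearMap.BilinForm ℝ (LieBaseChange ℝ ℂ L) :=
  B.compl₁₂ reC reC + B.compl₁₂ imC imC

lemma complexificationForm_apply (X Y : LieBaseChange ℝ ℂ L) :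
    complexificationForm B X Y = B (reC X) (reC Y) + B (imC X) (imC Y) := rfl

lemma complexificationForm_pos (hpos : ∀ x, x ≠ 0 → 0 < B x x) (X : LieBaseChange ℝ ℂ L)
    (hX : X ≠ 0) : 0 < complexificationForm B X X := by
  have hnn : ∀ x, 0 ≤ B x x := fun x => by
    rcases eq_or_ne x 0 with rfl | h
    · simp
    · exact (hpos x h).le
  rw [complexificationForm_apply]
  by_cases h : reC X = 0
  · have h' : imC X ≠ 0 := fun h' => hX (complexification_ext (by simpa using h) (by simpa using h'))
    exact add_pos_of_nonneg_of_pos (hnn _) (hpos _ h')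
  · exact add_pos_of_pos_of_nonneg (hpos _ h) (hnn _)

variable (hpos : ∀ x, x ≠ 0 → 0 < B x x) (hsymm : ∀ x y, B x y = B y x)
  (hinv : ∀ a x y : L, B ⁅a, x⁆ y + B x ⁅a, y⁆ = 0)

include hpos hsymm hinv

/-- The eigenvalues of `ad a` are purely imaginary if there is an invariant inner product. -/
lemma re_eq_zero_of_lie_eq_smul {a : L} {c : ℂ} {X : LieBaseChange ℝ ℂ L} (hX : X ≠ 0)
    (h : ⁅toLieBaseChange ℝ ℂ a, X⁆ = c • X) : c.re = 0 := by
  have h1 : ⁅a, reC X⁆ = c.re • reC X - c.im • imC X := by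
    rw [← reComplexification_lie, h, reComplexification_smul]
  have h2 : ⁅a, imC X⁆ = c.re • imC X + c.im • reC X := by
    rw [← imComplexification_lie, h, imComplexification_smul]
  have h3 := hinv a (reC X) (reC X)
  have h4 := hinv a (imC X) (imC X)
  rw [hsymm (reC X)] at h3
  rw [hsymm (imC X)] at h4
  simp only [h1, h2, map_sub, map_add, map_smul, LinearMap.sub_apply, LinearMap.add_apply,
    LinearMap.smul_apply, smul_eq_mul] at h3 h4
  have h5 := complexificationForm_pos hpos X hX
  rw [complexificationForm_apply] at h5
  -- Adding the invariance identities for the real and imaginary parts cancels the cross terms in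
  -- `c.im` by symmetry of `B`.
  have h6 : c.re * (B (reC X) (reC X) + B (imC X) (imC X)) = 0 := by
    have h7 := hsymm (reC X) (imC X)
    linear_combination (h3 + h4) / 2 - c.im * h7
  exact (mul_eq_zero.mp h6).resolve_right h5.ne'

/-- `ad a` has no generalized eigenvectors if there is an invariant inner product. -/
lemma lie_eq_smul_of_mem_maxGenEigenspace {a : L} {c : ℂ} {X : LieBaseChange ℝ ℂ L}
    (h : X ∈ Module.End.maxGenEigenspace
      (LieModule.toEnd ℂ (LieBaseChange ℝ ℂ L) (LieBaseChange ℝ ℂ L) (toLieBaseChange ℝ ℂ a)) c) :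
    ⁅toLieBaseChange ℝ ℂ a, X⁆ = c • X := by
  obtain ⟨k, hk⟩ := Module.End.mem_genEigenspace_top.mp h
  rw [LinearMap.mem_ker] at hk
  set N := LieModule.toEnd ℂ (LieBaseChange ℝ ℂ L) (LieBaseChange ℝ ℂ L) (toLieBaseChange ℝ ℂ a) -
    c • 1 with hN
  have hNa : ∀ Y, N Y = ⁅toLieBaseChange ℝ ℂ a, Y⁆ - c • Y := fun Y => rfl
  have hN2 : ∀ Y, N (N Y) = 0 → N Y = 0 := by
    intro Y hY
    by_contra hY0
    -- `N Y` would be an eigenvector for `c`, so `c` is imaginary. Only then is `N = ad a - c` skew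
    -- for the real form, and skewness forces `N Y = 0`.
    have hc : c.re = 0 := by
      refine re_eq_zero_of_lie_eq_smul hpos hsymm hinv hY0 (a := a) ?_
      rw [hNa (N Y), sub_eq_zero] at hY
      exact hY
    refine hY0 (apply_eq_zero_of_skew (complexificationForm_pos hpos) (N := N) ?_ Y hY)
    intro Z W
    have h1 := hinv a (reC Z) (reC W)
    have h2 := hinv a (imC Z) (imC W)
    simp only [complexificationForm_apply, hNa, map_sub, reComplexification_lie,
      imComplexification_lie, reComplexification_smul, imComplexification_smul, hc, map_add,
      map_smul, LinearMap.sub_apply, LinearMap.add_apply, LinearMap.smul_apply, smul_eq_mul,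
      zero_smul, map_zero, LinearMap.zero_apply]
    linarith
  have := apply_eq_zero_of_pow_succ_apply_eq_zero N hN2 k X (by
    rw [pow_succ', Module.End.mul_apply, hk, map_zero])
  rwa [hNa, sub_eq_zero] at this

variable {h : LieSubalgebra ℝ L}

omit hsymm in
/-- A nilpotent subalgebra of a Lie algebra with invariant inner product is abelian. -/
lemma lie_eq_zero_of_isCartanSubalgebra (hc : h.IsCartanSubalgebra) (a b : h) :
    ⁅(a : L), (b : L)⁆ = 0 := by
  have := hc
  -- Nilpotency of `𝔥` makes `ad a` nilpotent on `𝔥`; being also skew there, it is zero.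
  obtain ⟨k, hk⟩ := LieModule.exists_forall_pow_toEnd_eq_zero ℝ h h
  have hskew : ∀ x y : h, (B.compl₁₂ h.toSubmodule.subtype h.toSubmodule.subtype)
      (LieModule.toEnd ℝ h h a x) y + (B.compl₁₂ h.toSubmodule.subtype h.toSubmodule.subtype)
      x (LieModule.toEnd ℝ h h a y) = 0 := fun x y => hinv a x y
  have := apply_eq_zero_of_pow_succ_apply_eq_zero (LieModule.toEnd ℝ h h a)
    (apply_eq_zero_of_skew (B := B.compl₁₂ h.toSubmodule.subtype h.toSubmodule.subtype)
      (fun x hx => hpos _ (by simpa using hx)) hskew) k b (by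
      rw [pow_succ', Module.End.mul_apply, hk a, LinearMap.zero_apply, map_zero])
  simpa using congrArg (Subtype.val) this

/-- Conjugation commutes with `ad H` for real `H` and conjugates its eigenvalue. Eigenvalues on
nonzero vectors are imaginary, so conjugating them changes their sign. -/
lemma conjComplexification_mem_rootSpaceC {α : h →ₗ[ℝ] ℂ} {X : LieBaseChange ℝ ℂ L}
    (hX : X ∈ rootSpaceC h α) : conjComplexification X ∈ rootSpaceC h (-α) := by
  intro H
  rcases eq_or_ne X 0 with rfl | hX0
  · simp [conjComplexification]
  have h0 := hX H
  have hre := re_eq_zero_of_lie_eq_smul hpos hsymm hinv hX0 h0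
  have h1 := congrArg reC h0
  have h2 := congrArg imC h0
  rw [reComplexification_lie, reComplexification_smul, hre] at h1
  rw [imComplexification_lie, imComplexification_smul, hre] at h2
  apply complexification_ext
  · rw [reComplexification_lie, reComplexification_smul, reComplexification_conj,
      imComplexification_conj, h1]
    simp [hre]
  · rw [imComplexification_lie, imComplexification_smul, reComplexification_conj,
      imComplexification_conj, lie_neg, h2]
    simp [hre]

/-- The complexification is spanned by the Cartan subalgebra and the root spaces. -/
lemma complexification_induction [FiniteDimensional ℝ L] (hc : h.IsCartanSubalgebra)
    {p : LieBaseChange ℝ ℂ L → Prop} (hzero : p 0) (hadd : ∀ X Y, p X → p Y → p (X + Y))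
    (hcartan : ∀ X, reC X ∈ h → imC X ∈ h → p X)
    (hroot : ∀ α ∈ rootsC h, ∀ X ∈ rootSpaceC h α, p X) (X : LieBaseChange ℝ ℂ L) : p X := by
  -- Over `ℂ` the commuting operators `ad H` decompose the space into joint generalized eigenspaces,
  -- which here are genuine eigenspaces.
  have htop := Module.End.iSup_iInf_maxGenEigenspace_eq_top_of_iSup_maxGenEigenspace_eq_top_of_commute
    (fun H : h => LieModule.toEnd ℂ (LieBaseChange ℝ ℂ L) (LieBaseChange ℝ ℂ L)
      (toLieBaseChange ℝ ℂ (H : L))) (by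
      intro a b _
      refine LinearMap.ext fun Y => ?_
      have : ⁅toLieBaseChange ℝ ℂ (a : L), toLieBaseChange ℝ ℂ (b : L)⁆ = 0 := by
        rw [toLieBaseChange, toLieBaseChange, LieAlgebra.ExtendScalars.bracket_tmul,
          lie_eq_zero_of_isCartanSubalgebra hpos hinv hc, TensorProduct.tmul_zero]
      have h2 := lie_lie (toLieBaseChange ℝ ℂ (a : L)) (toLieBaseChange ℝ ℂ (b : L)) Y
      rw [this, zero_lie] at h2
      exact sub_eq_zero.mp h2.symm)
    (fun H => Module.End.iSup_maxGenEigenspace_eq_top _)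
  have hX : X ∈ ⨆ χ : h → ℂ, ⨅ H : h, Module.End.maxGenEigenspace
      (LieModule.toEnd ℂ (LieBaseChange ℝ ℂ L) (LieBaseChange ℝ ℂ L)
        (toLieBaseChange ℝ ℂ (H : L))) (χ H) := by
    rw [htop]; trivial
  refine Submodule.iSup_induction _ (motive := p) hX ?_ hzero hadd
  intro χ Y hY
  have hY' : ∀ H : h, ⁅toLieBaseChange ℝ ℂ (H : L), Y⁆ = χ H • Y := fun H =>
    lie_eq_smul_of_mem_maxGenEigenspace hpos hsymm hinv ((Submodule.mem_iInf _).mp hY H)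
  rcases eq_or_ne Y 0 with rfl | hY0
  · exact hzero
  -- The eigenvalue on `Y ≠ 0` is unique, so the function `χ` is automatically real-linear in `H`.
  have hinj := smul_left_injective ℂ hY0
  let α : h →ₗ[ℝ] ℂ :=
    { toFun := χ
      map_add' := fun a b => hinj (by
        simp only [add_smul, ← hY', AddMemClass.coe_add, toLieBaseChange, TensorProduct.tmul_add,
          add_lie])
      map_smul' := fun r a => hinj (by
        have : (r • χ a) • Y = r • (χ a • Y) := smul_assoc _ _ _
        simp only [RingHom.id_apply, this, ← hY', SetLike.val_smul, toLieBaseChange,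
          TensorProduct.tmul_smul, smul_lie]) }
  by_cases hα : α = 0
  · have hself := hc.self_normalizing
    -- The zero weight space is the centralizer of `𝔥`; it lies in the normalizer, which is `𝔥`
    -- itself.
    have key : ∀ x : L, (∀ H : h, ⁅(H : L), x⁆ = 0) → x ∈ h := fun x hx => by
      rw [← hself, LieSubalgebra.mem_normalizer_iff']
      intro y hy
      rw [hx ⟨y, hy⟩]
      exact h.zero_mem
    have hχ : ∀ H, χ H = 0 := fun H => congrArg (fun f : h →ₗ[ℝ] ℂ => f H) hα
    refine hcartan Y (key _ fun H => ?_) (key _ fun H => ?_)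
    · rw [← reComplexification_lie, hY', hχ, zero_smul, map_zero]
    · rw [← imComplexification_lie, hY', hχ, zero_smul, map_zero]
  · have hYα : Y ∈ rootSpaceC h α := hY'
    exact hroot α ⟨hα, fun hbot => hY0 (by rwa [hbot, Submodule.mem_bot] at hYα)⟩ Y hYα

/-- A real-linear map from a Lie algebra with invariant inner product to a complex vector space that
vanishes on a Cartan subalgebra and whose complex-linear extension vanishes on the positive root
spaces has a range that is stable under multiplication by `i`. -/
theorem exists_eq_I_smul_of_isPositiveRoots [FiniteDimensional ℝ L] (hc : h.IsCartanSubalgebra)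
    {P : Set (h →ₗ[ℝ] ℂ)} (hP : IsPositiveRoots h P) {V : Type*} [AddCommGroup V] [Module ℂ V]
    [Module ℝ V] [IsScalarTower ℝ ℂ V] (b : L →ₗ[ℝ] V) (hb : ∀ H : h, b H = 0)
    (hbP : ∀ α ∈ P, ∀ X ∈ rootSpaceC h α, LinearMap.liftBaseChange ℂ b X = 0) (x : L) :
    ∃ y, b y = Complex.I • b x := by
  set bC := LinearMap.liftBaseChange ℂ b with hbC
  have hone : ∀ x, bC ((1 : ℂ) ⊗ₜ[ℝ] x) = b x := fun x => by simp [hbC]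
  -- Root components of a real element need not be real. The claim is therefore put in terms of `X +
  -- X̄`, which allows induction over all complex `X`; the factor `1/2` compensates for the doubling
  -- of real elements.
  suffices key : ∀ X : LieBaseChange ℝ ℂ L,
      ∃ y, b y = Complex.I • bC (X + conjComplexification X) by
    obtain ⟨y, hy⟩ := key ((1 : ℂ) ⊗ₜ[ℝ] ((1 / 2 : ℝ) • x))
    refine ⟨y, ?_⟩
    rw [hy, add_conjComplexification, hone]
    simp [smul_smul]
  have hmem : ∀ X : LieBaseChange ℝ ℂ L, ∃ y, b y = bC (X + conjComplexification X) := fun X =>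
    ⟨_, by rw [add_conjComplexification, hone]⟩
  refine complexification_induction hpos hsymm hinv hc ⟨0, by simp [conjComplexification]⟩ ?_ ?_ ?_
  · rintro X Y ⟨x, hx⟩ ⟨y, hy⟩
    refine ⟨x + y, ?_⟩
    rw [map_add, hx, hy, ← smul_add, ← map_add, add_conjComplexification, add_conjComplexification,
      add_conjComplexification, ← TensorProduct.tmul_add, map_add, smul_add]
  · intro X hX _
    refine ⟨0, ?_⟩
    rw [add_conjComplexification, hone, map_smul, hb ⟨_, hX⟩, smul_zero, smul_zero, map_zero]
  · intro α hα X hX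
    have hconj := conjComplexification_mem_rootSpaceC hpos hsymm hinv hX
    have hI : conjComplexification (Complex.I • X) = -(Complex.I • conjComplexification X) := by
      apply complexification_ext <;>
        simp [reComplexification_conj, imComplexification_conj, reComplexification_smul,
          imComplexification_smul]
    by_cases hαP : α ∈ P
    -- Here `bC X = 0`, so `bC(iX + conj(iX)) = -i bC X̄`; this is the source of the sign in `-y`.
    · obtain ⟨y, hy⟩ := hmem (Complex.I • X)
      refine ⟨-y, ?_⟩
      rw [map_neg, hy, hI, map_add, map_add, map_neg, map_smul, map_smul, hbP α hαP X hX]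
      simp
    · have hneg : -α ∈ P := by
        rcases hP.split α hα with h1 | h1
        · exact absurd h1.1 hαP
        · exact h1.1
      -- Here `bC X̄ = 0`, so `bC(iX + conj(iX)) = i bC X` already has the right sign.
      obtain ⟨y, hy⟩ := hmem (Complex.I • X)
      refine ⟨y, ?_⟩
      rw [hy, hI, map_add, map_add, map_neg, map_smul, map_smul, hbP _ hneg _ hconj]
      simp

end Invariant

end Complexification

end LinearAlgebra

/-! ### The Lie bracket as the derivative of the adjoint action -/

noncomputable section LieGroups

open Filter VectorField

variable (n : ℕ) {G : Type*} [TopologicalSpace G] [ChartedSpace (EuclideanSpace ℝ (Fin n)) G]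
  [Group G]

variable (G) in
/-- The group multiplication, read in the preferred chart at the identity. -/
def mulInChart (p : EuclideanSpace ℝ (Fin n) × EuclideanSpace ℝ (Fin n)) :
    EuclideanSpace ℝ (Fin n) :=
  extChartAt (𝓡 n) (1 : G)
    ((extChartAt (𝓡 n) (1 : G)).symm p.1 * (extChartAt (𝓡 n) (1 : G)).symm p.2)

/-- Conjugation by `g`, read in the preferred chart at the identity. -/
def conjInChart (g : G) (y : EuclideanSpace ℝ (Fin n)) : EuclideanSpace ℝ (Fin n) :=
  extChartAt (𝓡 n) (1 : G) (g * (extChartAt (𝓡 n) (1 : G)).symm y * g⁻¹)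

/-- The adjoint action of a Lie group on its Lie algebra, as the derivative of conjugation. -/
def adjointAction (g : G) : EuclideanSpace ℝ (Fin n) →L[ℝ] EuclideanSpace ℝ (Fin n) :=
  fderiv ℝ (conjInChart n g) (extChartAt (𝓡 n) (1 : G) 1)

lemma conjInChart_self (g : G) :
    conjInChart n g (extChartAt (𝓡 n) (1 : G) 1) = extChartAt (𝓡 n) (1 : G) 1 := by
  simp [conjInChart]

variable [LieGroup (𝓡 n) ∞ G]

variable (G) in
lemma contMDiffAt_extChartAt_symm_one :
    ContMDiffAt 𝓘(ℝ, EuclideanSpace ℝ (Fin n)) (𝓡 n) ∞ (extChartAt (𝓡 n) (1 : G)).symm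
      (extChartAt (𝓡 n) (1 : G) 1) :=
  (contMDiffOn_extChartAt_symm (I := 𝓡 n) (n := ∞) (1 : G)).contMDiffAt
    (extChartAt_target_mem_nhds (1 : G))

/-- Smoothness is needed jointly in `g` and `y`, so that the derivative in `y` still depends
differentiably on `g`. -/
lemma contMDiffAt_conjInChart (g : G) :
    ContMDiffAt ((𝓡 n).prod 𝓘(ℝ, EuclideanSpace ℝ (Fin n))) 𝓘(ℝ, EuclideanSpace ℝ (Fin n)) ∞
      (Function.uncurry (conjInChart n (G := G))) (g, extChartAt (𝓡 n) (1 : G) 1) := by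
  have h1 : ContMDiffAt ((𝓡 n).prod 𝓘(ℝ, EuclideanSpace ℝ (Fin n))) (𝓡 n) ∞
      (fun p : G × EuclideanSpace ℝ (Fin n) => (extChartAt (𝓡 n) (1 : G)).symm p.2)
      (g, extChartAt (𝓡 n) (1 : G) 1) :=
    ContMDiffAt.comp (g, extChartAt (𝓡 n) (1 : G) 1) (contMDiffAt_extChartAt_symm_one n G)
      contMDiffAt_snd
  have h2 : ContMDiffAt ((𝓡 n).prod 𝓘(ℝ, EuclideanSpace ℝ (Fin n))) (𝓡 n) ∞
      (fun p : G × EuclideanSpace ℝ (Fin n) =>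
        p.1 * (extChartAt (𝓡 n) (1 : G)).symm p.2 * p.1⁻¹)
      (g, extChartAt (𝓡 n) (1 : G) 1) :=
    (contMDiffAt_fst.mul h1).mul contMDiffAt_fst.inv
  refine ContMDiffAt.comp (g, extChartAt (𝓡 n) (1 : G) 1) ?_ h2
  have : g * (extChartAt (𝓡 n) (1 : G)).symm (extChartAt (𝓡 n) (1 : G) 1) * g⁻¹ = 1 := by simp
  simp only [this]
  exact contMDiffAt_extChartAt

lemma hasFDerivAt_conjInChart (g : G) :
    HasFDerivAt (conjInChart n g) (adjointAction n g) (extChartAt (𝓡 n) (1 : G) 1) := by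
  have h : ContMDiffAt 𝓘(ℝ, EuclideanSpace ℝ (Fin n)) 𝓘(ℝ, EuclideanSpace ℝ (Fin n)) ∞
      (conjInChart n g) (extChartAt (𝓡 n) (1 : G) 1) :=
    ContMDiffAt.comp (g := Function.uncurry (conjInChart n (G := G))) (f := fun y => (g, y))
      (extChartAt (𝓡 n) (1 : G) 1) (contMDiffAt_conjInChart n g)
      (contMDiffAt_const.prodMk contMDiffAt_id)
  exact (h.contDiffAt.differentiableAt (by simp)).hasFDerivAt

variable (G) in
lemma contMDiff_adjointAction :
    ContMDiff (𝓡 n) 𝓘(ℝ, EuclideanSpace ℝ (Fin n) →L[ℝ] EuclideanSpace ℝ (Fin n)) 1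
      (adjointAction n (G := G)) := by
  intro g
  have h := ContMDiffAt.mfderiv (I := 𝓘(ℝ, EuclideanSpace ℝ (Fin n)))
    (I' := 𝓘(ℝ, EuclideanSpace ℝ (Fin n))) (J := 𝓡 n) (m := 1) (n := ∞) (conjInChart n (G := G))
    (fun _ => extChartAt (𝓡 n) (1 : G) 1) (contMDiffAt_conjInChart n g) contMDiffAt_const
    (by decide)
  refine h.congr_of_eventuallyEq (Eventually.of_forall fun x => ?_)
  refine Eq.trans ?_ (congrFun (inTangentCoordinates_model_space _ _ _ _) x).symm
  exact mfderiv_eq_fderiv.symm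

/-- Chain rule for conjugation by `g * k`. All conjugations fix the base point, and the inner chart
and its inverse cancel near it. -/
lemma adjointAction_mul (g k : G) :
    adjointAction n (g * k) = (adjointAction n g).comp (adjointAction n k) := by
  have h1 := hasFDerivAt_conjInChart n k
  have h2 := hasFDerivAt_conjInChart n g
  rw [← conjInChart_self n k] at h2
  refine ((h2.comp _ h1).congr_of_eventuallyEq ?_).fderiv
  have hc : ContinuousAt (fun y => k * (extChartAt (𝓡 n) (1 : G)).symm y * k⁻¹)
      (extChartAt (𝓡 n) (1 : G) 1) := by
    have := topologicalGroup_of_lieGroup (𝓡 n) ∞ (G := G)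
    exact (continuousAt_const.mul (contMDiffAt_extChartAt_symm_one n G).continuousAt).mul
      continuousAt_const
  have hs : (extChartAt (𝓡 n) (1 : G)).source ∈
      𝓝 (k * (extChartAt (𝓡 n) (1 : G)).symm (extChartAt (𝓡 n) (1 : G) 1) * k⁻¹) := by
    simpa using extChartAt_source_mem_nhds (I := 𝓡 n) (1 : G)
  filter_upwards [hc.preimage_mem_nhds hs] with y hy
  simp only [conjInChart, Function.comp_apply]
  rw [(extChartAt (𝓡 n) (1 : G)).left_inv hy]
  congr 1
  group

variable (G) in
omit [LieGroup (𝓡 n) ∞ G] in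
lemma adjointAction_one : adjointAction n (1 : G) = ContinuousLinearMap.id ℝ _ := by
  refine ((hasFDerivAt_id _).congr_of_eventuallyEq ?_).fderiv
  filter_upwards [extChartAt_target_mem_nhds (I := 𝓡 n) (1 : G)] with y hy
  simpa [conjInChart] using (extChartAt (𝓡 n) (1 : G)).right_inv hy

variable (G) in
lemma contDiffAt_mulInChart :
    ContDiffAt ℝ ∞ (mulInChart n G) (extChartAt (𝓡 n) (1 : G) 1, extChartAt (𝓡 n) (1 : G) 1) := by
  set o := extChartAt (𝓡 n) (1 : G) 1
  have h1 : ContMDiffAt 𝓘(ℝ, EuclideanSpace ℝ (Fin n) × EuclideanSpace ℝ (Fin n)) (𝓡 n) ∞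
      (fun p : EuclideanSpace ℝ (Fin n) × EuclideanSpace ℝ (Fin n) =>
        (extChartAt (𝓡 n) (1 : G)).symm p.1) (o, o) :=
    ContMDiffAt.comp (o, o) (contMDiffAt_extChartAt_symm_one n G) contDiffAt_fst.contMDiffAt
  have h2 : ContMDiffAt 𝓘(ℝ, EuclideanSpace ℝ (Fin n) × EuclideanSpace ℝ (Fin n)) (𝓡 n) ∞
      (fun p : EuclideanSpace ℝ (Fin n) × EuclideanSpace ℝ (Fin n) =>
        (extChartAt (𝓡 n) (1 : G)).symm p.2) (o, o) :=
    ContMDiffAt.comp (o, o) (contMDiffAt_extChartAt_symm_one n G) contDiffAt_snd.contMDiffAt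
  refine ContMDiffAt.contDiffAt (ContMDiffAt.comp (o, o) ?_ (h1.mul h2))
  have : (extChartAt (𝓡 n) (1 : G)).symm o * (extChartAt (𝓡 n) (1 : G)).symm o = 1 := by simp [o]
  simp only [this]
  exact contMDiffAt_extChartAt

variable (G) in
lemma eventually_differentiableAt_mulInChart :
    ∀ᶠ p in 𝓝 (extChartAt (𝓡 n) (1 : G) 1, extChartAt (𝓡 n) (1 : G) 1),
      DifferentiableAt ℝ (mulInChart n G) p := by
  have h := (contDiffAt_mulInChart n G).of_le (show (1 : WithTop ℕ∞) ≤ ∞ by decide)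
  filter_upwards [h.eventually (by decide)] with p hp
  exact hp.differentiableAt (by simp)

/-- Left translation factors through the adjoint action and right translation. -/
lemma eventually_fderiv_mulInChart_adjointAction (w : EuclideanSpace ℝ (Fin n)) :
    ∀ᶠ x in 𝓝 (extChartAt (𝓡 n) (1 : G) 1),
      fderiv ℝ (mulInChart n G) (extChartAt (𝓡 n) (1 : G) 1, x)
        (adjointAction n ((extChartAt (𝓡 n) (1 : G)).symm x) w, 0) =
      fderiv ℝ (mulInChart n G) (x, extChartAt (𝓡 n) (1 : G) 1) (0, w) := by
  set o := extChartAt (𝓡 n) (1 : G) 1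
  have hd := eventually_differentiableAt_mulInChart n G
  have hr : Tendsto (fun x => (o, x)) (𝓝 o) (𝓝 (o, o)) :=
    (continuous_const.prodMk continuous_id).tendsto o
  have hl : Tendsto (fun x => (x, o)) (𝓝 o) (𝓝 (o, o)) :=
    (continuous_id.prodMk continuous_const).tendsto o
  filter_upwards [hr.eventually hd, hl.eventually hd] with x hx1 hx2
  set g := (extChartAt (𝓡 n) (1 : G)).symm x
  have h1 : HasFDerivAt (fun y => mulInChart n G (conjInChart n g y, x))
      ((fderiv ℝ (mulInChart n G) (o, x)).comp ((adjointAction n g).prod 0)) o := by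
    have h2 : HasFDerivAt (fun y => (conjInChart n g y, x)) ((adjointAction n g).prod 0) o :=
      (hasFDerivAt_conjInChart n g).prodMk (hasFDerivAt_const _ _)
    have h3 : HasFDerivAt (mulInChart n G) (fderiv ℝ (mulInChart n G) (o, x))
        (conjInChart n g o, x) := by
      rw [conjInChart_self]; exact hx1.hasFDerivAt
    exact h3.comp o h2
  have h4 : HasFDerivAt (fun y => mulInChart n G (x, y))
      ((fderiv ℝ (mulInChart n G) (x, o)).comp
        ((0 : EuclideanSpace ℝ (Fin n) →L[ℝ] EuclideanSpace ℝ (Fin n)).prod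
          (ContinuousLinearMap.id ℝ _))) o :=
    hx2.hasFDerivAt.comp o ((hasFDerivAt_const x o).prodMk (hasFDerivAt_id o))
  -- This is `(g y g⁻¹) g = g y`, valid in the chart as long as `g y g⁻¹` stays in its domain.
  -- Differentiating both sides in `y` at the identity gives the claim.
  have heq : (fun y => mulInChart n G (conjInChart n g y, x)) =ᶠ[𝓝 o]
      fun y => mulInChart n G (x, y) := by
    have hc : ContinuousAt (fun y => g * (extChartAt (𝓡 n) (1 : G)).symm y * g⁻¹) o := by
      have := topologicalGroup_of_lieGroup (𝓡 n) ∞ (G := G)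
      exact (continuousAt_const.mul (contMDiffAt_extChartAt_symm_one n G).continuousAt).mul
        continuousAt_const
    have hs : (extChartAt (𝓡 n) (1 : G)).source ∈
        𝓝 (g * (extChartAt (𝓡 n) (1 : G)).symm o * g⁻¹) := by
      simpa [o] using extChartAt_source_mem_nhds (I := 𝓡 n) (1 : G)
    filter_upwards [hc.preimage_mem_nhds hs] with y hy
    simp only [mulInChart, conjInChart]
    rw [(extChartAt (𝓡 n) (1 : G)).left_inv hy, inv_mul_cancel_right]
  have := congrArg (fun f : EuclideanSpace ℝ (Fin n) →L[ℝ] EuclideanSpace ℝ (Fin n) => f w)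
    ((h4.congr_of_eventuallyEq heq).unique h1)
  simpa using this.symm

variable (G) in
lemma fderiv_mulInChart_left (w : EuclideanSpace ℝ (Fin n)) :
    fderiv ℝ (mulInChart n G) (extChartAt (𝓡 n) (1 : G) 1, extChartAt (𝓡 n) (1 : G) 1) (w, 0) =
      w := by
  set o := extChartAt (𝓡 n) (1 : G) 1
  have hd := (eventually_differentiableAt_mulInChart n G).self_of_nhds
  have h1 : HasFDerivAt (fun y => mulInChart n G (y, o))
      ((fderiv ℝ (mulInChart n G) (o, o)).comp ((ContinuousLinearMap.id ℝ _).prod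
        (0 : EuclideanSpace ℝ (Fin n) →L[ℝ] EuclideanSpace ℝ (Fin n)))) o :=
    HasFDerivAt.comp (f := fun y => (y, o)) o hd.hasFDerivAt ((hasFDerivAt_id o).prodMk (hasFDerivAt_const o o))
  have h2 : (fun y => mulInChart n G (y, o)) =ᶠ[𝓝 o] id := by
    filter_upwards [extChartAt_target_mem_nhds (I := 𝓡 n) (1 : G)] with y hy
    simpa [mulInChart, o] using (extChartAt (𝓡 n) (1 : G)).right_inv hy
  have := congrArg (fun f : EuclideanSpace ℝ (Fin n) →L[ℝ] EuclideanSpace ℝ (Fin n) => f w)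
    (((hasFDerivAt_id o).congr_of_eventuallyEq h2).unique h1)
  simpa using this.symm

/-- The left-invariant field at `g` is the derivative of `y ↦ g * y` at the identity, that is, a
partial derivative of the multiplication. Brackets thereby become second derivatives of one map. -/
lemma eventually_mpullbackWithin_mulInvariantVectorField (v : GroupLieAlgebra (𝓡 n) G) :
    ∀ᶠ x in 𝓝 (extChartAt (𝓡 n) (1 : G) 1),
      mpullbackWithin 𝓘(ℝ, EuclideanSpace ℝ (Fin n)) (𝓡 n) (extChartAt (𝓡 n) (1 : G)).symm
        (mulInvariantVectorField v) (Set.range (𝓡 n)) x =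
      fderiv ℝ (mulInChart n G) (x, extChartAt (𝓡 n) (1 : G) 1)
        ((0 : EuclideanSpace ℝ (Fin n)), (v : EuclideanSpace ℝ (Fin n))) := by
  set o := extChartAt (𝓡 n) (1 : G) 1 with ho
  have hl : Tendsto (fun x => (x, o)) (𝓝 o) (𝓝 (o, o)) :=
    (continuous_id.prodMk continuous_const).tendsto o
  filter_upwards [hl.eventually (eventually_differentiableAt_mulInChart n G),
    extChartAt_target_mem_nhds (I := 𝓡 n) (1 : G)] with x hx hxt
  set g := (extChartAt (𝓡 n) (1 : G)).symm x with hg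
  have hinv : (mfderivWithin 𝓘(ℝ, EuclideanSpace ℝ (Fin n)) (𝓡 n)
      (extChartAt (𝓡 n) (1 : G)).symm (Set.range (𝓡 n)) x).inverse =
      mfderiv (𝓡 n) 𝓘(ℝ, EuclideanSpace ℝ (Fin n)) (extChartAt (𝓡 n) (1 : G)) g :=
    ContinuousLinearMap.inverse_eq
      (mfderivWithin_extChartAt_symm_comp_mfderiv_extChartAt hxt)
      (mfderiv_extChartAt_comp_mfderivWithin_extChartAt_symm hxt)
  have hgs : g ∈ (chartAt (EuclideanSpace ℝ (Fin n)) (1 : G)).source := by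
    rw [← extChartAt_source (𝓡 n)]
    exact (extChartAt (𝓡 n) (1 : G)).map_target hxt
  have hme : MDifferentiableAt (𝓡 n) 𝓘(ℝ, EuclideanSpace ℝ (Fin n)) (extChartAt (𝓡 n) (1 : G))
      (g * 1) := by
    rw [mul_one]; exact mdifferentiableAt_extChartAt hgs
  have hml : MDifferentiableAt (𝓡 n) (𝓡 n) (fun y : G => g * y) 1 :=
    mdifferentiableAt_mul_left (I := 𝓡 n)
  have h0 : HasMFDerivAt (𝓡 n) 𝓘(ℝ, EuclideanSpace ℝ (Fin n))
      (extChartAt (𝓡 n) (1 : G) ∘ (fun y : G => g * y)) 1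
      ((mfderiv (𝓡 n) 𝓘(ℝ, EuclideanSpace ℝ (Fin n)) (extChartAt (𝓡 n) (1 : G)) (g * 1)).comp
        (mfderiv (𝓡 n) (𝓡 n) (fun y : G => g * y) 1)) :=
    hme.hasMFDerivAt.comp 1 hml.hasMFDerivAt
  obtain ⟨D, hD, hDv⟩ : ∃ D : EuclideanSpace ℝ (Fin n) →L[ℝ] EuclideanSpace ℝ (Fin n),
      HasFDerivAt (fun y => mulInChart n G (x, y)) D o ∧
      D v = mfderiv (𝓡 n) 𝓘(ℝ, EuclideanSpace ℝ (Fin n)) (extChartAt (𝓡 n) (1 : G)) (g * 1)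
        (mfderiv (𝓡 n) (𝓡 n) (fun y : G => g * y) 1 v) := by
    refine ⟨ContinuousLinearMap.comp (M₁ := EuclideanSpace ℝ (Fin n))
      (M₂ := EuclideanSpace ℝ (Fin n)) (M₃ := EuclideanSpace ℝ (Fin n))
      (mfderiv (𝓡 n) 𝓘(ℝ, EuclideanSpace ℝ (Fin n)) (extChartAt (𝓡 n) (1 : G)) (g * 1))
      (mfderiv (𝓡 n) (𝓡 n) (fun y : G => g * y) 1), ?_, rfl⟩
    refine HasFDerivWithinAt.hasFDerivAt (s := Set.range (𝓡 n)) h0.2 ?_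
    rw [ModelWithCorners.range_eq_univ]
    exact univ_mem
  have h4 : HasFDerivAt (fun y => mulInChart n G (x, y))
      ((fderiv ℝ (mulInChart n G) (x, o)).comp
        ((0 : EuclideanSpace ℝ (Fin n) →L[ℝ] EuclideanSpace ℝ (Fin n)).prod
          (ContinuousLinearMap.id ℝ _))) o :=
    hx.hasFDerivAt.comp o ((hasFDerivAt_const x o).prodMk (hasFDerivAt_id o))
  have h5 : D v = fderiv ℝ (mulInChart n G) (x, o) ((0 : EuclideanSpace ℝ (Fin n)), v) := by
    rw [hD.unique h4]; rfl
  rw [mpullbackWithin_apply, hinv, ← h5, hDv]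
  -- `δ` has a type independent of the base point, so `g * 1` can be replaced by `g` without
  -- transport between tangent spaces.
  let δ : G → (EuclideanSpace ℝ (Fin n) →L[ℝ] EuclideanSpace ℝ (Fin n)) := fun k =>
    mfderiv (𝓡 n) 𝓘(ℝ, EuclideanSpace ℝ (Fin n)) (extChartAt (𝓡 n) (1 : G)) k
  exact congrArg (fun k => δ k (mfderiv (𝓡 n) (𝓡 n) (fun y : G => g * y) 1 v)) (mul_one g).symm


variable (G) in
lemma hasFDerivAt_adjointAction :
    ∃ A' : EuclideanSpace ℝ (Fin n) →L[ℝ] EuclideanSpace ℝ (Fin n) →L[ℝ] EuclideanSpace ℝ (Fin n),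
      HasFDerivAt (fun x => adjointAction n ((extChartAt (𝓡 n) (1 : G)).symm x)) A'
        (extChartAt (𝓡 n) (1 : G) 1) := by
  have h : ContMDiffAt 𝓘(ℝ, EuclideanSpace ℝ (Fin n))
      𝓘(ℝ, EuclideanSpace ℝ (Fin n) →L[ℝ] EuclideanSpace ℝ (Fin n)) 1
      (fun x => adjointAction n ((extChartAt (𝓡 n) (1 : G)).symm x))
      (extChartAt (𝓡 n) (1 : G) 1) :=
    (contMDiff_adjointAction n G).contMDiffAt.comp _
      ((contMDiffAt_extChartAt_symm_one n G).of_le (by decide))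
  exact ⟨_, (h.contDiffAt.differentiableAt (by simp)).hasFDerivAt⟩

/-- The bracket of left-invariant vector fields, read in a chart, is the derivative of the adjoint
action. -/
lemma lieBracket_fderiv_mulInChart
    {A' : EuclideanSpace ℝ (Fin n) →L[ℝ] EuclideanSpace ℝ (Fin n) →L[ℝ] EuclideanSpace ℝ (Fin n)}
    (hA : HasFDerivAt (fun x => adjointAction n ((extChartAt (𝓡 n) (1 : G)).symm x)) A'
      (extChartAt (𝓡 n) (1 : G) 1)) (v w : EuclideanSpace ℝ (Fin n)) :
    lieBracket ℝ (fun x => fderiv ℝ (mulInChart n G) (x, extChartAt (𝓡 n) (1 : G) 1) (0, v))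
      (fun x => fderiv ℝ (mulInChart n G) (x, extChartAt (𝓡 n) (1 : G) 1) (0, w))
      (extChartAt (𝓡 n) (1 : G) 1) = A' v w := by
  set o := extChartAt (𝓡 n) (1 : G) 1 with ho
  set D := fderiv ℝ (fderiv ℝ (mulInChart n G)) (o, o) with hD
  have hm := contDiffAt_mulInChart n G
  have hsymm : ∀ p q, D p q = D q p := fun p q =>
    (hm.isSymmSndFDerivAt (by simp; decide)) p q
  have hdd : HasFDerivAt (fderiv ℝ (mulInChart n G)) D (o, o) :=
    ((hm.fderiv_right (m := 1) (by decide)).differentiableAt (by simp)).hasFDerivAt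
  have hleft : ∀ w : EuclideanSpace ℝ (Fin n),
      HasFDerivAt (fun x => fderiv ℝ (mulInChart n G) (x, o) (0, w))
        ((D.comp (ContinuousLinearMap.inl ℝ _ _)).flip (0, w)) o := fun w => by
    have h1 : HasFDerivAt (fun x => (x, o)) (ContinuousLinearMap.inl ℝ
        (EuclideanSpace ℝ (Fin n)) (EuclideanSpace ℝ (Fin n))) o := hasFDerivAt_prodMk_left o o
    have h2 : HasFDerivAt (fun x => fderiv ℝ (mulInChart n G) (x, o)) _ o :=
      HasFDerivAt.comp (f := fun x => (x, o)) o hdd h1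
    simpa using h2.clm_apply (hasFDerivAt_const ((0 : EuclideanSpace ℝ (Fin n)), w) o)
  have hone : (extChartAt (𝓡 n) (1 : G)).symm o = 1 := by simp [ho]
  have hright : ∀ w : EuclideanSpace ℝ (Fin n), fderiv ℝ (mulInChart n G) (o, o) (0, w) = w :=
    fun w => by
      rw [← (eventually_fderiv_mulInChart_adjointAction (G := G) n w).self_of_nhds, ← ho, hone,
        adjointAction_one]
      exact fderiv_mulInChart_left n G w
  have hF : HasFDerivAt (fun x => fderiv ℝ (mulInChart n G) (o, x)
      (adjointAction n ((extChartAt (𝓡 n) (1 : G)).symm x) w, 0)) _ o :=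
    (HasFDerivAt.comp (f := fun x => (o, x)) o hdd (hasFDerivAt_prodMk_right o o)).clm_apply
      ((hA.clm_apply (hasFDerivAt_const w o)).prodMk
        (hasFDerivAt_const (0 : EuclideanSpace ℝ (Fin n)) o))
  have huniq := congrArg
    (fun f : EuclideanSpace ℝ (Fin n) →L[ℝ] EuclideanSpace ℝ (Fin n) => f v)
    (((hleft w).congr_of_eventuallyEq
      (eventually_fderiv_mulInChart_adjointAction n w)).unique hF)
  -- The product rule for `∂₁m(o, x)(Ad(x) w) = ∂₂m(x, o) w` in direction `v`. It gives `D(v,0)(0,w)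
  -- = A' v w + D(0,v)(w,0)`, and symmetry of `D` turns the last term into the other half of the
  -- bracket.
  have huniq' : D (v, 0) (0, w) =
      fderiv ℝ (mulInChart n G) (o, o) (adjointAction n ((extChartAt (𝓡 n) (1 : G)).symm o) 0 +
        A' v w, 0) + D (0, v) (adjointAction n ((extChartAt (𝓡 n) (1 : G)).symm o) w, 0) := huniq
  rw [hone, adjointAction_one, ContinuousLinearMap.id_apply, ContinuousLinearMap.id_apply, zero_add,
    fderiv_mulInChart_left, hsymm] at huniq'
  have hfin : lieBracket ℝ (fun x => fderiv ℝ (mulInChart n G) (x, o) (0, v))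
      (fun x => fderiv ℝ (mulInChart n G) (x, o) (0, w)) o = D (v, 0) (0, w) - D (w, 0) (0, v) := by
    rw [lieBracket, (hleft v).fderiv, (hleft w).fderiv, hright, hright]
    rfl
  rw [hfin, hsymm (v, 0), hsymm (w, 0), huniq']
  abel

/-- The tangent space at `x` is identified with the model space by the preferred chart at `x`, so
that chart has identity derivative there. -/
lemma inverse_mfderiv_extChartAt_self {𝕜 E H M : Type*} [NontriviallyNormedField 𝕜]
    [NormedAddCommGroup E] [NormedSpace 𝕜 E] [TopologicalSpace H] {I : ModelWithCorners 𝕜 E H}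
    [TopologicalSpace M] [ChartedSpace H M] [IsManifold I 1 M] (x : M) (v : E) :
    (mfderiv I 𝓘(𝕜, E) (extChartAt I x) x).inverse v = v := by
  let δ : E →L[𝕜] E := mfderiv I 𝓘(𝕜, E) (extChartAt I x) x
  have hδ : δ = ContinuousLinearMap.id 𝕜 E := mfderiv_extChartAt_self
  have h : δ.inverse v = v := by
    rw [hδ, ContinuousLinearMap.inverse_id, ContinuousLinearMap.id_apply]
  exact h

/-- The derivative of the adjoint action at the identity is the Lie bracket. -/
theorem lie_eq_hasFDerivAt_adjointAction
    {A' : EuclideanSpace ℝ (Fin n) →L[ℝ] EuclideanSpace ℝ (Fin n) →L[ℝ] EuclideanSpace ℝ (Fin n)}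
    (hA : HasFDerivAt (fun x => adjointAction n ((extChartAt (𝓡 n) (1 : G)).symm x)) A'
      (extChartAt (𝓡 n) (1 : G) 1)) (v w : GroupLieAlgebra (𝓡 n) G) :
    (⁅v, w⁆ : GroupLieAlgebra (𝓡 n) G) = A' v w := by
  refine Eq.trans ?_ (lieBracket_fderiv_mulInChart n hA v w)
  set o := extChartAt (𝓡 n) (1 : G) 1 with ho
  have hs : (extChartAt (𝓡 n) (1 : G)).symm ⁻¹' Set.univ ∩ Set.range (𝓡 n) = Set.univ := by
    rw [ModelWithCorners.range_eq_univ, Set.preimage_univ, Set.inter_univ]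
  have h1 : lieBracketWithin ℝ
      (mpullbackWithin 𝓘(ℝ, EuclideanSpace ℝ (Fin n)) (𝓡 n) (extChartAt (𝓡 n) (1 : G)).symm
        (mulInvariantVectorField v) (Set.range (𝓡 n)))
      (mpullbackWithin 𝓘(ℝ, EuclideanSpace ℝ (Fin n)) (𝓡 n) (extChartAt (𝓡 n) (1 : G)).symm
        (mulInvariantVectorField w) (Set.range (𝓡 n))) Set.univ o =
      lieBracketWithin ℝ (fun x => fderiv ℝ (mulInChart n G) (x, o)
          ((0 : EuclideanSpace ℝ (Fin n)), (v : EuclideanSpace ℝ (Fin n))))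
        (fun x => fderiv ℝ (mulInChart n G) (x, o)
          ((0 : EuclideanSpace ℝ (Fin n)), (w : EuclideanSpace ℝ (Fin n)))) Set.univ o :=
    Filter.EventuallyEq.lieBracketWithin_vectorField_eq_nhds
      (E := EuclideanSpace ℝ (Fin n))
      (eventually_mpullbackWithin_mulInvariantVectorField n v)
      (eventually_mpullbackWithin_mulInvariantVectorField n w)
  rw [lieBracketWithin_univ] at h1
  refine Eq.trans ?_ h1
  rw [GroupLieAlgebra.bracket_def, ← mlieBracketWithin_univ, mlieBracketWithin_apply, hs]
  exact inverse_mfderiv_extChartAt_self (1 : G) _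

end LieGroups

/-! ### Invariant inner product by Haar averaging -/

noncomputable section LieGroups

open Filter MeasureTheory

variable (n : ℕ) (G : Type*) [TopologicalSpace G] [ChartedSpace (EuclideanSpace ℝ (Fin n)) G]
  [Group G] [LieGroup (𝓡 n) ∞ G]

lemma continuous_inner_adjointAction_inv (v w : EuclideanSpace ℝ (Fin n)) :
    Continuous fun g : G => ⟪adjointAction n g⁻¹ v, adjointAction n g⁻¹ w⟫_ℝ := by
  have := topologicalGroup_of_lieGroup (𝓡 n) ∞ (G := G)
  have h := (contMDiff_adjointAction n G).continuous.comp continuous_inv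
  exact (h.clm_apply continuous_const).inner (h.clm_apply continuous_const)

/-- The adjoint action of a compact Lie group preserves an inner product. -/
theorem exists_adjointAction_invariant_form [CompactSpace G] :
    ∃ B : LinearMap.BilinForm ℝ (EuclideanSpace ℝ (Fin n)), (∀ v, v ≠ 0 → 0 < B v v) ∧
      (∀ v w, B v w = B w v) ∧
      ∀ (g : G) (v w), B (adjointAction n g v) (adjointAction n g w) = B v w := by
  have htop := topologicalGroup_of_lieGroup (𝓡 n) ∞ (G := G)
  have : LocallyCompactSpace G := ChartedSpace.locallyCompactSpace (EuclideanSpace ℝ (Fin n)) G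
  let _ : MeasurableSpace G := borel G
  have : BorelSpace G := ⟨rfl⟩
  let μ : Measure G := Measure.haar
  have hint : ∀ v w : EuclideanSpace ℝ (Fin n),
      Integrable (fun g : G => ⟪adjointAction n g⁻¹ v, adjointAction n g⁻¹ w⟫_ℝ) μ := fun v w =>
    (continuous_inner_adjointAction_inv n G v w).integrable_of_hasCompactSupport
      (HasCompactSupport.of_compactSpace _)
  refine ⟨LinearMap.mk₂ ℝ (fun v w => ∫ g : G, ⟪adjointAction n g⁻¹ v, adjointAction n g⁻¹ w⟫_ℝ ∂μ)
    ?_ ?_ ?_ ?_, ?_, ?_, ?_⟩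
  · intro v v' w
    simp only [map_add, inner_add_left]
    exact integral_add (hint _ _) (hint _ _)
  · intro c v w
    simp only [map_smul, real_inner_smul_left, integral_const_mul, smul_eq_mul]
  · intro v w w'
    simp only [map_add, inner_add_right]
    exact integral_add (hint _ _) (hint _ _)
  · intro c v w
    simp only [map_smul, real_inner_smul_right, integral_const_mul, smul_eq_mul]
  · intro v hv
    refine (continuous_inner_adjointAction_inv n G v v).integral_pos_of_hasCompactSupport_nonneg_nonzero
      (HasCompactSupport.of_compactSpace _) (fun g => real_inner_self_nonneg) (x := 1) ?_
    rw [inv_one, adjointAction_one, ContinuousLinearMap.id_apply]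
    exact inner_self_ne_zero.mpr hv
  · intro v w
    simp only [LinearMap.mk₂_apply, real_inner_comm]
  · intro k v w
    simp only [LinearMap.mk₂_apply]
    -- Averaging over `Ad(g⁻¹)` suits a left-invariant measure: replacing `g` by `k⁻¹g` turns `g⁻¹`
    -- into `g⁻¹k`.
    rw [← integral_mul_left_eq_self
      (fun g : G => ⟪adjointAction n g⁻¹ v, adjointAction n g⁻¹ w⟫_ℝ) k⁻¹]
    simp only [mul_inv_rev, inv_inv, adjointAction_mul, ContinuousLinearMap.comp_apply]

/-- A form that is invariant under the adjoint action is infinitesimally invariant. -/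
lemma invariant_form_hasFDerivAt_adjointAction
    {B : LinearMap.BilinForm ℝ (EuclideanSpace ℝ (Fin n))}
    (hinv : ∀ (g : G) (v w), B (adjointAction n g v) (adjointAction n g w) = B v w)
    {A' : EuclideanSpace ℝ (Fin n) →L[ℝ] EuclideanSpace ℝ (Fin n) →L[ℝ] EuclideanSpace ℝ (Fin n)}
    (hA : HasFDerivAt (fun x => adjointAction n ((extChartAt (𝓡 n) (1 : G)).symm x)) A'
      (extChartAt (𝓡 n) (1 : G) 1)) (a v w : EuclideanSpace ℝ (Fin n)) :
    B (A' a v) w + B v (A' a w) = 0 := by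
  let b : EuclideanSpace ℝ (Fin n) →L[ℝ] EuclideanSpace ℝ (Fin n) →L[ℝ] ℝ :=
    LinearMap.toContinuousBilinearMap (𝕜 := ℝ) (E := EuclideanSpace ℝ (Fin n))
      (F := EuclideanSpace ℝ (Fin n)) (G := ℝ) B
  have hA' := fun u : EuclideanSpace ℝ (Fin n) => hA.clm_apply
    (hasFDerivAt_const u (extChartAt (𝓡 n) (1 : G) 1))
  have h1 : HasFDerivAt (fun x => b (adjointAction n ((extChartAt (𝓡 n) (1 : G)).symm x) v)
      (adjointAction n ((extChartAt (𝓡 n) (1 : G)).symm x) w)) _ (extChartAt (𝓡 n) (1 : G) 1) :=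
    b.hasFDerivAt_of_bilinear (hA' v) (hA' w)
  have h2 : HasFDerivAt (fun x => b (adjointAction n ((extChartAt (𝓡 n) (1 : G)).symm x) v)
      (adjointAction n ((extChartAt (𝓡 n) (1 : G)).symm x) w))
      (0 : EuclideanSpace ℝ (Fin n) →L[ℝ] ℝ) (extChartAt (𝓡 n) (1 : G) 1) := by
    simp only [b, LinearMap.toContinuousBilinearMap_apply, hinv]
    exact hasFDerivAt_const _ _
  have h3 := congrArg (fun f : EuclideanSpace ℝ (Fin n) →L[ℝ] ℝ => f a) (h1.unique h2)
  have hone : (extChartAt (𝓡 n) (1 : G)).symm (extChartAt (𝓡 n) (1 : G) 1) = 1 :=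
    extChartAt_to_inv (I := 𝓡 n) (1 : G)
  simp only [hone, adjointAction_one] at h3
  simpa [add_comm, b] using h3

/-- The Lie algebra of a compact Lie group has an inner product for which all `ad A` are
skew-symmetric. -/
theorem exists_lie_invariant_form [CompactSpace G] :
    ∃ B : LinearMap.BilinForm ℝ (GroupLieAlgebra (𝓡 n) G), (∀ v, v ≠ 0 → 0 < B v v) ∧
      (∀ v w, B v w = B w v) ∧
      ∀ a v w : GroupLieAlgebra (𝓡 n) G, B ⁅a, v⁆ w + B v ⁅a, w⁆ = 0 := by
  obtain ⟨B, hpos, hsymm, hinv⟩ := exists_adjointAction_invariant_form n G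
  refine ⟨B, hpos, hsymm, fun a v w => ?_⟩
  obtain ⟨A', hA⟩ := hasFDerivAt_adjointAction n G
  rw [lie_eq_hasFDerivAt_adjointAction n hA, lie_eq_hasFDerivAt_adjointAction n hA]
  exact invariant_form_hasFDerivAt_adjointAction n G hinv hA a v w

end LieGroups

/-! ### Tangent spaces of families of states -/

noncomputable section TangentSpaces

open Filter

variable {V : Type*} [NormedAddCommGroup V] [InnerProductSpace ℂ V]

/-- A real subspace of a Hilbert space that is stable under multiplication by `i` is a Kähler
space. -/
theorem isKahlerSpace_of_I_smul_mem {ψ : V} (hψ : ψ ≠ 0) {T : Submodule ℝ V}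
    (hT : ∀ X ∈ T, Complex.I • X ∈ T) :
    IsKahlerSpace (restrictedMetric ψ T) (restrictedSymplectic ψ T) := by
  have hψ' : 0 < ‖ψ‖ ^ 2 := by positivity
  have hg : ∀ X Y : T, restrictedMetric ψ T X Y = 2 * (⟪(X : V), (Y : V)⟫_ℂ).re / ‖ψ‖ ^ 2 :=
    fun _ _ => rfl
  have hs : ∀ X Y : T, restrictedSymplectic ψ T X Y = 2 * (⟪(X : V), (Y : V)⟫_ℂ).im / ‖ψ‖ ^ 2 :=
    fun _ _ => rfl
  let J : T →ₗ[ℝ] T :=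
    { toFun := fun X => ⟨Complex.I • (X : V), hT X X.2⟩
      map_add' := fun X Y => Subtype.ext (smul_add _ _ _)
      map_smul' := fun r X => Subtype.ext (smul_comm _ _ _) }
  have hJ : ∀ X, ((J X : T) : V) = Complex.I • (X : V) := fun _ => rfl
  have hpos : ∀ X : T, X ≠ 0 → 0 < 2 * (⟪(X : V), (X : V)⟫_ℂ).re / ‖ψ‖ ^ 2 := fun X hX => by
    have h1 : (⟪(X : V), (X : V)⟫_ℂ).re = ‖(X : V)‖ ^ 2 :=
      inner_self_eq_norm_sq (𝕜 := ℂ) (X : V)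
    have : 0 < ‖(X : V)‖ := norm_pos_iff.mpr (by simpa using hX)
    rw [h1]
    positivity
  refine ⟨?_, ?_, ?_, ?_, J, ?_, ?_⟩
  · intro X Y
    rw [hg, hg, ← inner_conj_symm, Complex.conj_re]
  · intro X hX
    exact hpos X hX
  · intro X Y
    rw [hs, hs, ← inner_conj_symm, Complex.conj_im]
    ring
  · intro X hX
    by_contra hX0
    -- Pairing with `iX` gives `σ(X, iX) = g(X, X)`.
    have h1 := hX (J X)
    rw [hs, hJ, inner_smul_right, Complex.mul_im, Complex.I_re, Complex.I_im, zero_mul, one_mul,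
      zero_add] at h1
    exact (hpos X hX0).ne' h1
  · intro X Y
    rw [hg, hs, hJ, inner_smul_right, Complex.mul_re, Complex.I_re, Complex.I_im]
    ring
  · intro X
    apply Subtype.ext
    rw [hJ, hJ, smul_smul, Complex.I_mul_I, neg_one_smul]
    rfl

/-- If the values of `ψ` and `χ` are proportional near `x`, then so are their derivatives at `x`,
modulo the line of `χ x`. -/
lemma starProjection_hasFDerivAt_of_proportional {E : Type*} [NormedAddCommGroup E]
    [NormedSpace ℝ E] {ψ χ : E → V} {x : E} {ψ' χ' : E →L[ℝ] V} (hψ : HasFDerivAt ψ ψ' x)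
    (hχ : HasFDerivAt χ χ' x) (hχx : χ x ≠ 0) {c : ℂ} (hc : ψ x = c • χ x)
    (h : ∀ᶠ y in 𝓝 x, ∃ k : ℂ, ψ y = k • χ y) (v : E) :
    (ℂ ∙ χ x)ᗮ.starProjection (ψ' v) = c • (ℂ ∙ χ x)ᗮ.starProjection (χ' v) := by
  let Q : V →L[ℝ] V := (ℂ ∙ χ x)ᗮ.starProjection.restrictScalars ℝ
  let ℓ : V →L[ℝ] ℂ := (innerSL ℂ (χ x)).restrictScalars ℝ
  have hQ : ∀ (k : ℂ) (w : V), Q (k • w) = k • Q w := fun k w =>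
    (ℂ ∙ χ x)ᗮ.starProjection.map_smul k w
  have hℓ : ∀ (k : ℂ) (w : V), ℓ (k • w) = k * ℓ w := fun k w => (innerSL ℂ (χ x)).map_smul k w
  have hQχ : Q (χ x) = 0 := by
    change (ℂ ∙ χ x)ᗮ.starProjection (χ x) = 0
    rw [Submodule.starProjection_apply_eq_zero_iff]
    exact Submodule.le_orthogonal_orthogonal _ (Submodule.mem_span_singleton_self _)
  have hQψ : Q (ψ x) = 0 := by rw [hc, hQ, hQχ, smul_zero]
  -- The factor `k` is not known to be differentiable, so it is eliminated through `ℓ(χ) Qψ = ℓ(ψ)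
  -- Qχ`. At `x` both `Qψ` and `Qχ` vanish, so only the terms with `Qψ'` and `Qχ'` survive.
  have h1 : HasFDerivAt (fun y => ℓ (χ y) • Q (ψ y)) _ x :=
    (ℓ.hasFDerivAt.comp x hχ).smul (Q.hasFDerivAt.comp x hψ)
  have h2 : HasFDerivAt (fun y => ℓ (ψ y) • Q (χ y)) _ x :=
    (ℓ.hasFDerivAt.comp x hψ).smul (Q.hasFDerivAt.comp x hχ)
  have heq : (fun y => ℓ (χ y) • Q (ψ y)) =ᶠ[𝓝 x] fun y => ℓ (ψ y) • Q (χ y) := by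
    filter_upwards [h] with y hy
    obtain ⟨k, hk⟩ := hy
    rw [hk, hQ, hℓ, smul_smul, mul_comm]
  have h3 := congrArg (fun f : E →L[ℝ] V => f v) (h1.unique (h2.congr_of_eventuallyEq heq))
  simp only [add_apply, smul_apply,
    ContinuousLinearMap.smulRight_apply, ContinuousLinearMap.comp_apply, Function.comp_apply, hQχ,
    hQψ, smul_zero, add_zero] at h3
  rw [hc, hℓ, mul_comm, mul_smul] at h3
  have hℓχ : ℓ (χ x) ≠ 0 := inner_self_ne_zero.mpr hχx
  exact smul_right_injective V hℓχ h3

variable {n : ℕ} {N : Type*} [TopologicalSpace N] [ChartedSpace (EuclideanSpace ℝ (Fin n)) N]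

lemma mem_stateTangentSpace {ψ : N → V} {x : N} {X : V} :
    X ∈ stateTangentSpace n ψ x ↔ ∃ v : TangentSpace (𝓡 n) x,
      (ℂ ∙ ψ x)ᗮ.starProjection (mfderiv (𝓡 n) 𝓘(ℝ, V) ψ x v) = X := Iff.rfl

lemma IsLocalLift.ne_zero {f : N → ℙ ℂ V} {x : N} {ψ : N → V} (h : IsLocalLift n f x ψ) :
    ψ x ≠ 0 := h.lifts.self_of_nhds.1

lemma hasFDerivAt_of_mdifferentiableAt {ψ : N → V} {x : N}
    (h : MDifferentiableAt (𝓡 n) 𝓘(ℝ, V) ψ x) :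
    ∃ D : EuclideanSpace ℝ (Fin n) →L[ℝ] V,
      HasFDerivAt (ψ ∘ (extChartAt (𝓡 n) x).symm) D (extChartAt (𝓡 n) x x) ∧
      ∀ v, D v = mfderiv (𝓡 n) 𝓘(ℝ, V) ψ x v := by
  refine ⟨mfderiv (𝓡 n) 𝓘(ℝ, V) ψ x, ?_, fun _ => rfl⟩
  refine HasFDerivWithinAt.hasFDerivAt (s := Set.range (𝓡 n)) h.hasMFDerivAt.2 ?_
  rw [ModelWithCorners.range_eq_univ]
  exact univ_mem

/-- The tangent spaces defined by two choices of representatives of the same family differ by a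
scalar factor. -/
lemma smul_mem_stateTangentSpace {f : N → ℙ ℂ V} {x : N} {ψ χ : N → V} (hψ : IsLocalLift n f x ψ)
    (hχ : IsLocalLift n f x χ) {c : ℂ} (hc : ψ x = c • χ x) {X : V}
    (hX : X ∈ stateTangentSpace n χ x) : c • X ∈ stateTangentSpace n ψ x := by
  have hc0 : c ≠ 0 := by
    rintro rfl
    exact hψ.ne_zero (by rw [hc, zero_smul])
  obtain ⟨v, rfl⟩ := mem_stateTangentSpace.mp hX
  refine mem_stateTangentSpace.mpr ⟨v, ?_⟩
  have hspan : (ℂ ∙ ψ x) = (ℂ ∙ χ x) := by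
    rw [hc]; exact Submodule.span_singleton_smul_eq hc0.isUnit _
  simp only [hspan]
  obtain ⟨Dψ, hDψ, hDψv⟩ := hasFDerivAt_of_mdifferentiableAt hψ.differentiableAt
  obtain ⟨Dχ, hDχ, hDχv⟩ := hasFDerivAt_of_mdifferentiableAt hχ.differentiableAt
  have hinv : (extChartAt (𝓡 n) x).symm (extChartAt (𝓡 n) x x) = x := extChartAt_to_inv x
  have h1 : ∀ᶠ y in 𝓝 x, ∃ k : ℂ, ψ y = k • χ y := by
    filter_upwards [hψ.lifts, hχ.lifts] with y hy1 hy2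
    obtain ⟨hy1, hy1'⟩ := hy1
    obtain ⟨hy2, hy2'⟩ := hy2
    obtain ⟨a, ha⟩ := (Projectivization.mk_eq_mk_iff' ℂ _ _ hy1 hy2).mp (hy1'.trans hy2'.symm)
    exact ⟨a, ha.symm⟩
  have h2 : ∀ᶠ y in 𝓝 (extChartAt (𝓡 n) x x), ∃ k : ℂ,
      (ψ ∘ (extChartAt (𝓡 n) x).symm) y = k • (χ ∘ (extChartAt (𝓡 n) x).symm) y := by
    have ht := (continuousAt_extChartAt_symm (I := 𝓡 n) x).tendsto
    rw [hinv] at ht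
    exact ht.eventually h1
  have h3 := starProjection_hasFDerivAt_of_proportional hDψ hDχ (c := c)
    (by rw [Function.comp_apply, hinv]; exact hχ.ne_zero)
    (by rw [Function.comp_apply, Function.comp_apply, hinv]; exact hc) h2 v
  rw [Function.comp_apply, hinv] at h3
  exact (congrArg (fun u : V => (ℂ ∙ χ x)ᗮ.starProjection u) (hDψv v)).symm.trans
    (h3.trans (congrArg (fun u : V => c • (ℂ ∙ χ x)ᗮ.starProjection u) (hDχv v)))

/-- The tangent space does not depend on the parametrization. -/
lemma stateTangentSpace_comp {χ : N → V} {τ σ : N → N} {x : N}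
    (hχ : MDifferentiableAt (𝓡 n) 𝓘(ℝ, V) χ (τ x)) (hτ : MDifferentiableAt (𝓡 n) (𝓡 n) τ x)
    (hσ : MDifferentiableAt (𝓡 n) (𝓡 n) σ (τ x)) (hστ : σ (τ x) = x) (hτσ : ∀ y, τ (σ y) = y) :
    stateTangentSpace n (χ ∘ τ) x = stateTangentSpace n χ (τ x) := by
  have h1 : mfderiv (𝓡 n) 𝓘(ℝ, V) (χ ∘ τ) x =
      (mfderiv (𝓡 n) 𝓘(ℝ, V) χ (τ x)).comp (mfderiv (𝓡 n) (𝓡 n) τ x) := mfderiv_comp x hχ hτ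
  ext X
  rw [mem_stateTangentSpace, mem_stateTangentSpace, h1]
  constructor
  · rintro ⟨v, hv⟩
    exact ⟨mfderiv (𝓡 n) (𝓡 n) τ x v, hv⟩
  · rintro ⟨v, hv⟩
    -- Since `τ ∘ σ = id`, the derivative of `τ` at `x` is surjective, so no tangent direction is
    -- lost.
    have h2 : HasMFDerivAt (𝓡 n) (𝓡 n) (τ ∘ σ) (τ x)
        ((mfderiv (𝓡 n) (𝓡 n) τ x).comp (mfderiv (𝓡 n) (𝓡 n) σ (τ x))) := by
      refine HasMFDerivAt.comp (τ x) ?_ hσ.hasMFDerivAt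
      rw [hστ]
      exact hτ.hasMFDerivAt
    have h3 : τ ∘ σ = id := funext hτσ
    rw [h3] at h2
    have h4 := hasMFDerivAt_unique h2 (hasMFDerivAt_id (I := 𝓡 n) (τ x))
    refine ⟨mfderiv (𝓡 n) (𝓡 n) σ (τ x) v, ?_⟩
    have h5 := congrArg (fun f : EuclideanSpace ℝ (Fin n) →L[ℝ] EuclideanSpace ℝ (Fin n) => f v) h4
    have h6 : mfderiv (𝓡 n) (𝓡 n) τ x (mfderiv (𝓡 n) (𝓡 n) σ (τ x) v) = v := h5
    exact (congrArg (fun u : EuclideanSpace ℝ (Fin n) =>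
      (ℂ ∙ χ (τ x))ᗮ.starProjection (mfderiv (𝓡 n) 𝓘(ℝ, V) χ (τ x) u)) h6).trans hv

/-- A unitary carries the complement of `χ x` to that of `W (χ x)`, hence intertwines the two
projections. -/
lemma stateTangentSpace_linearIsometryEquiv (W : V ≃ₗᵢ[ℂ] V) {χ : N → V} {x : N}
    (hχ : MDifferentiableAt (𝓡 n) 𝓘(ℝ, V) χ x) {X : V} :
    X ∈ stateTangentSpace n (fun y => W (χ y)) x ↔ W.symm X ∈ stateTangentSpace n χ x := by
  have h1 : HasMFDerivAt (𝓡 n) 𝓘(ℝ, V) (fun y => W (χ y)) x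
      (((W : V →L[ℂ] V).restrictScalars ℝ).comp (mfderiv (𝓡 n) 𝓘(ℝ, V) χ x)) :=
    ((W : V →L[ℂ] V).restrictScalars ℝ).hasMFDerivAt.comp x hχ.hasMFDerivAt
  have h2 : ∀ u : V, (ℂ ∙ W (χ x))ᗮ.starProjection (W u) = W ((ℂ ∙ χ x)ᗮ.starProjection u) := by
    intro u
    have h3 : (ℂ ∙ χ x).map (W.toLinearEquiv : V →ₗ[ℂ] V) = ℂ ∙ W (χ x) := by
      rw [Submodule.map_span, Set.image_singleton]
      rfl
    have h4 := Submodule.starProjection_map_apply W (ℂ ∙ χ x) (W u)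
    simp only [h3, W.symm_apply_apply] at h4
    rw [Submodule.starProjection_orthogonal_val, Submodule.starProjection_orthogonal_val, h4,
      map_sub]
  rw [mem_stateTangentSpace, mem_stateTangentSpace, h1.mfderiv]
  refine exists_congr fun v => ?_
  exact (iff_of_eq (congrArg (fun u : V => u = X) (h2 _))).trans
    (W.toEquiv.eq_symm_apply).symm

end TangentSpaces

/-! ### Coherent states: translations and the tangent space at the identity -/

noncomputable section CoherentStates

open Filter

variable {G V : Type*} [Group G] [NormedAddCommGroup V] [InnerProductSpace ℂ V]

lemma coherentState_eq_iff (U : ProjectiveUnitaryRep G V) {φ : V} (hφ : φ ≠ 0) (M K : G) :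
    coherentState U φ hφ M = coherentState U φ hφ K ↔
      ∃ c : ℂ, c • U.toFun K φ = U.toFun M φ :=
  Projectivization.mk_eq_mk_iff' ℂ _ _ _ _

/-- Right translation by an element of the stabilizer does not change the family of states. -/
lemma coherentState_mul_right (U : ProjectiveUnitaryRep G V) {φ : V} (hφ : φ ≠ 0) {M K : G}
    (h : coherentState U φ hφ M = coherentState U φ hφ K) (g : G) :
    coherentState U φ hφ (g * (M⁻¹ * K)) = coherentState U φ hφ g := by
  obtain ⟨c, hc⟩ := (coherentState_eq_iff U hφ _ _).mp h.symm
  obtain ⟨a, ha⟩ := U.mul M (M⁻¹ * K)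
  obtain ⟨b, hb⟩ := U.mul g (M⁻¹ * K)
  -- `U(M) U(M⁻¹K) φ` is a phase times `U(K) φ`, hence a multiple of `U(M) φ`; cancelling `U(M)`
  -- shows that `M⁻¹K` fixes the state of `φ`.
  have h1 : U.toFun M (U.toFun (M⁻¹ * K) φ) = U.toFun M ((a * c) • φ) := by
    rw [ha, mul_inv_cancel_left, ← hc, map_smul, smul_smul]
  have h2 := (U.toFun M).injective h1
  rw [coherentState_eq_iff]
  refine ⟨(b : ℂ)⁻¹ * (a * c), ?_⟩
  have h3 := hb φ
  rw [h2, map_smul] at h3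
  rw [mul_smul, h3, smul_smul, inv_mul_cancel₀ b.coe_ne_zero, one_smul]

variable [TopologicalSpace G] {n : ℕ} [ChartedSpace (EuclideanSpace ℝ (Fin n)) G]
  [LieGroup (𝓡 n) ∞ G]

lemma isLocalLift_one {U : ProjectiveUnitaryRep G V} {φ : V}
    {h : LieSubalgebra ℝ (GroupLieAlgebra (𝓡 n) G)} {P : Set (h →ₗ[ℝ] ℂ)} {θ : G → Circle}
    (H : IsHighestWeightFor n U φ h P θ) (hφ : φ ≠ 0) :
    IsLocalLift n (coherentState U φ hφ) 1 (fun M => (θ M : ℂ) • U.toFun M φ) := by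
  refine ⟨H.differentiableAt, Eventually.of_forall fun M => ?_⟩
  have h0 : U.toFun M φ ≠ 0 := (map_ne_zero_iff _ (U.toFun M).injective).mpr hφ
  exact ⟨smul_ne_zero (θ M).coe_ne_zero h0, (Projectivization.mk_eq_mk_iff' ℂ _ _ _ _).mpr
    ⟨(θ M : ℂ), rfl⟩⟩

/-- Representatives near `M` are obtained from representatives near `1` by left translation. -/
lemma IsLocalLift.left_translate {U : ProjectiveUnitaryRep G V} {φ : V} {hφ : φ ≠ 0} {ψ : G → V}
    (hψ : IsLocalLift n (coherentState U φ hφ) 1 ψ) (M : G) :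
    IsLocalLift n (coherentState U φ hφ) M (fun K => U.toFun M (ψ (M⁻¹ * K))) := by
  have hτ : MDifferentiableAt (𝓡 n) (𝓡 n) (fun K : G => M⁻¹ * K) M :=
    mdifferentiableAt_mul_left (I := 𝓡 n)
  have hψM : MDifferentiableAt (𝓡 n) 𝓘(ℝ, V) ψ (M⁻¹ * M) := by
    rw [inv_mul_cancel]; exact hψ.differentiableAt
  constructor
  · exact (((U.toFun M : V →L[ℂ] V).restrictScalars ℝ).mdifferentiableAt).comp M (hψM.comp M hτ)
  · have ht : Tendsto (fun K : G => M⁻¹ * K) (𝓝 M) (𝓝 1) := by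
      have := hτ.continuousAt.tendsto
      rwa [inv_mul_cancel] at this
    filter_upwards [ht.eventually hψ.lifts] with K hK
    obtain ⟨h1, h2⟩ := hK
    refine ⟨(map_ne_zero_iff _ (U.toFun M).injective).mpr h1, ?_⟩
    obtain ⟨c, hc⟩ := (Projectivization.mk_eq_mk_iff' ℂ _ _ _ _).mp h2
    obtain ⟨a, ha⟩ := U.mul M (M⁻¹ * K)
    refine (Projectivization.mk_eq_mk_iff' ℂ _ _ _ _).mpr ⟨c * a, ?_⟩
    rw [← hc, map_smul, ha, mul_inv_cancel_left, smul_smul]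

lemma stateTangentSpace_left_translate {ψ : G → V}
    (hψ : MDifferentiableAt (𝓡 n) 𝓘(ℝ, V) ψ 1) (W : V ≃ₗᵢ[ℂ] V) (M : G) {X : V} :
    X ∈ stateTangentSpace n (fun K => W (ψ (M⁻¹ * K))) M ↔ W.symm X ∈ stateTangentSpace n ψ 1 := by
  have hτ : MDifferentiableAt (𝓡 n) (𝓡 n) (fun K : G => M⁻¹ * K) M :=
    mdifferentiableAt_mul_left (I := 𝓡 n)
  have hψM : MDifferentiableAt (𝓡 n) 𝓘(ℝ, V) ψ (M⁻¹ * M) := by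
    rw [inv_mul_cancel]; exact hψ
  have h1 : stateTangentSpace n (ψ ∘ fun K => M⁻¹ * K) M = stateTangentSpace n ψ (M⁻¹ * M) :=
    stateTangentSpace_comp (σ := fun K => M * K) hψM hτ (mdifferentiableAt_mul_left (I := 𝓡 n))
      (by simp) (by simp)
  rw [inv_mul_cancel] at h1
  rw [← h1]
  exact stateTangentSpace_linearIsometryEquiv W (hψM.comp M hτ)

/-- The tangent space at a highest weight vector is a complex subspace. -/
theorem I_smul_mem_stateTangentSpace_one [CompactSpace G] {U : ProjectiveUnitaryRep G V} {φ : V}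
    {h : LieSubalgebra ℝ (GroupLieAlgebra (𝓡 n) G)} {P : Set (h →ₗ[ℝ] ℂ)} {θ : G → Circle}
    (H : IsHighestWeightFor n U φ h P θ) {X : V}
    (hX : X ∈ stateTangentSpace n (fun M => (θ M : ℂ) • U.toFun M φ) (1 : G)) :
    Complex.I • X ∈ stateTangentSpace n (fun M => (θ M : ℂ) • U.toFun M φ) (1 : G) := by
  set ψ : G → V := fun M => (θ M : ℂ) • U.toFun M φ with hψ
  have hψ1 : ψ 1 = φ := H.map_one
  obtain ⟨B, hpos, hsymm, hinv⟩ := exists_lie_invariant_form n G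
  let Q : V →ₗ[ℂ] V := (ℂ ∙ ψ 1)ᗮ.starProjection.toLinearMap
  let b : GroupLieAlgebra (𝓡 n) G →ₗ[ℝ] V := Q.restrictScalars ℝ ∘ₗ infinitesimalAction n ψ
  have hb : ∀ A : h, b A = 0 := by
    intro A
    obtain ⟨μ, hμ⟩ := H.weight
    have : b A = Q (μ A • φ) := congrArg Q (hμ A)
    rw [this, map_smul, ← hψ1]
    have hQ : Q (ψ 1) = 0 := Submodule.starProjection_orthogonal_apply_eq_zero
      (Submodule.mem_span_singleton_self _)
    rw [hQ, smul_zero]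
  have hbC : ∀ Y, LinearMap.liftBaseChange ℂ b Y = Q (infinitesimalActionC n ψ Y) := by
    intro Y
    induction Y using TensorProduct.induction_on with
    | zero => simp
    | tmul z A =>
      simp only [infinitesimalActionC, LinearMap.liftBaseChange_tmul, map_smul]
      rfl
    | add Y Z hY hZ => simp only [map_add, hY, hZ]
  have hfd : FiniteDimensional ℝ (GroupLieAlgebra (𝓡 n) G) :=
    inferInstanceAs (FiniteDimensional ℝ (EuclideanSpace ℝ (Fin n)))
  -- The tangent space is by definition the range of `b`.
  obtain ⟨A, rfl⟩ := hX
  exact exists_eq_I_smul_of_isPositiveRoots hpos hsymm hinv H.cartan H.positive b hb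
    (fun α hα Y hY => by rw [hbC, H.annihilated α hα Y hY, map_zero]) A

end CoherentStates

/-! ### Assembly of the theorem -/

theorem mainTheorem9 {n : ℕ} {G : Type*} [TopologicalSpace G]
    [ChartedSpace (EuclideanSpace ℝ (Fin n)) G] [Group G] [LieGroup (𝓡 n) ∞ G] [CompactSpace G]
    [LieAlgebra.IsSemisimple ℝ (GroupLieAlgebra (𝓡 n) G)]
    {V : Type*} [NormedAddCommGroup V] [InnerProductSpace ℂ V] [CompleteSpace V]
    (U : ProjectiveUnitaryRep G V) (φ : V) (hφ : IsHighestWeightVector n U φ) :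
    IsKahlerFamily n (coherentState U φ hφ.ne_zero) := by
  obtain ⟨h, P, θ, H⟩ := id hφ
  have hlift := isLocalLift_one H hφ.ne_zero
  refine ⟨fun M => ⟨_, hlift.left_translate M⟩, ?_, ?_⟩
  · intro M K ψ χ hψ hχ heq
    -- Equal representatives give equal states, so `M⁻¹K` lies in the stabilizer. Right translation
    -- by it sends `M` to `K` without changing the family, and the two lifts can be compared at `M`
    -- with scalar `1`.
    have hMK : coherentState U φ hφ.ne_zero M = coherentState U φ hφ.ne_zero K := by
      obtain ⟨h1, h2⟩ := hψ.lifts.self_of_nhds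
      obtain ⟨h3, h4⟩ := hχ.lifts.self_of_nhds
      rw [← h2, ← h4]
      simp only [heq]
    have hτ : MDifferentiableAt (𝓡 n) (𝓡 n) (fun g : G => g * (M⁻¹ * K)) M :=
      mdifferentiableAt_mul_right (I := 𝓡 n)
    have hMz : M * (M⁻¹ * K) = K := mul_inv_cancel_left M K
    have hχM : MDifferentiableAt (𝓡 n) 𝓘(ℝ, V) χ (M * (M⁻¹ * K)) := by
      rw [hMz]; exact hχ.differentiableAt
    have hχ' : IsLocalLift n (coherentState U φ hφ.ne_zero) M (χ ∘ fun g => g * (M⁻¹ * K)) := by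
      refine ⟨hχM.comp M hτ, ?_⟩
      have ht := hτ.continuousAt.tendsto
      simp only [hMz] at ht
      filter_upwards [ht.eventually hχ.lifts] with g hg
      rw [← coherentState_mul_right U hφ.ne_zero hMK g]
      exact hg
    have h1 : stateTangentSpace n (χ ∘ fun g => g * (M⁻¹ * K)) M =
        stateTangentSpace n χ (M * (M⁻¹ * K)) :=
      stateTangentSpace_comp (σ := fun g => g * (M⁻¹ * K)⁻¹) hχM hτ
        (mdifferentiableAt_mul_right (I := 𝓡 n)) (mul_inv_cancel_right _ _)
        (fun g => inv_mul_cancel_right g _)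
    rw [hMz] at h1
    rw [← h1]
    have h2 : (χ ∘ fun g => g * (M⁻¹ * K)) M = ψ M := by
      rw [Function.comp_apply, hMz, heq]
    apply le_antisymm
    · intro X hX
      simpa using smul_mem_stateTangentSpace (c := 1) hχ' hψ (by rw [h2, one_smul]) hX
    · intro X hX
      simpa using smul_mem_stateTangentSpace (c := 1) hψ hχ' (by rw [h2, one_smul]) hX
  · intro M ψ hψ
    refine isKahlerSpace_of_I_smul_mem hψ.ne_zero fun X hX => ?_
    have hM := hlift.left_translate M
    obtain ⟨h1, h2⟩ := hψ.lifts.self_of_nhds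
    obtain ⟨h3, h4⟩ := hM.lifts.self_of_nhds
    obtain ⟨c, hc⟩ := (Projectivization.mk_eq_mk_iff' ℂ _ _ _ _).mp (h2.trans h4.symm)
    have hc0 : c ≠ 0 := by
      rintro rfl
      exact h1 (by rw [← hc, zero_smul])
    -- Rescaling by `c⁻¹` and applying `U(M)⁻¹` moves `X` to the tangent space at the identity.
    -- Multiplication by `i` commutes with both operations, so they can be undone afterwards.
    have h5 := smul_mem_stateTangentSpace (c := c⁻¹) hM hψ
      (by rw [← hc, smul_smul, inv_mul_cancel₀ hc0, one_smul]) hX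
    rw [stateTangentSpace_left_translate hlift.differentiableAt (U.toFun M)] at h5
    have h6 := I_smul_mem_stateTangentSpace_one H h5
    rw [← map_smul, ← stateTangentSpace_left_translate hlift.differentiableAt] at h6
    have h7 := smul_mem_stateTangentSpace hψ hM hc.symm h6
    rwa [smul_comm c, smul_smul c, mul_inv_cancel₀ hc0, one_smul] at h7
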